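/- Let $V$ be a complex Hilbert space, with inner product $\langle\cdot|\cdot\rangle$ antilinear in the first variable. Let $SV=\bigoplus_{d\ge 0}S^dV$ be its (algebraic) symmetric algebra, with the inner product for which $\langle x_1\cdots x_d|y_1\cdots y_d\rangle=\sum_{\pi}\prod_k\langle x_k|y_{\pi(k)}\rangle$ and different degrees are perpendicular. Let $SV'$ be the space of all antilinear functionals $SV\to\mathbb C$; it is a commutative algebra under $[\Phi\Psi](\theta)=[\Phi\otimes\Psi](\Delta\theta)$, where $\Delta:SV\to SV\otimes SV$ is the coproduct with $\Delta v=v\otimes 1+1\otimes v$ for $v\in V$, and it contains $SV$ as a subalgebra through $\phi\mapsto\langle\cdot|\phi\rangle$. Symmetric Fock space $S[V]\subset SV'$ consists of the functionals $\Phi$ with $\|\Phi\|=\sup\{|\Phi(\psi)|:\psi\in SV,\ \|\psi\|\le 1\}<\infty$. For $v\in V$ the creator $c(v)$ on $SV$ is multiplication by $v$, and the annihilator $a(v)$ on $SV$ is the linear derivation with $a(v)w=\langle v|w\rangle$ for $w\in V$; on $SV'$ they act by $[c(v)\Phi](\psi)=\Phi(a(v)\psi)$ and $[a(v)\Phi](\psi)=\Phi(c(v)\psi)$.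 As operators in $S[V]$ they have the natural domains $\{\Phi\in S[V]:c(v)\Phi\in S[V]\}$ and $\{\Phi\in S[V]:a(v)\Phi\in S[V]\}$, and sums and products of them have the usual domains of sums and products of unbounded operators. Let $Z:V\to V$ be a Hilbert–Schmidt antilinear map that is symmetric, $\langle y|Zx\rangle=\langle x|Zy\rangle$ for all $x,y\in V$, and has operator norm $\|Z\|<1$. Let $\zeta\in SV'$ be the functional that vanishes on $S^dV$ for $d\ne 2$ and satisfies $\zeta(xy)=\langle y|Zx\rangle$ for $x,y\in V$, and let $e^Z=\sum_{n\ge 0}\zeta^n/n!\in SV'$ (on each element of $SV$ only finitely many terms are nonzero). Then $\phi\,e^Z\in S[V]$ for every $\phi\in SV$. Moreover, for every polynomial $p=\sum_w p_w w$ in creators and annihilators (a finite linear combination of finite products $w=A_1\cdots A_n$ with each $A_i$ a $c(v)$ or an $a(v)$), the vector $e^Z$ lies in the domain of $p$ as an operator in $S[V]$, that is, $e^Z\in S[V]$ and, for each product $A_1\cdots A_n$ occurring in $p$, all the vectors $A_j\cdots A_n e^Z$ ($1\le j\le n$) lie in $S[V]$; in particular $p\,e^Z\in S[V]$. -/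

import Mathlib

open scoped InnerProductSpace ENNReal TensorProduct ComplexConjugate

noncomputable section

namespace BosonicFock

universe u

variable (V : Type u) [NormedAddCommGroup V] [InnerProductSpace ℂ V]

/-! ### The symmetric algebra and its full antidual -/

/-- The (purely algebraic) symmetric algebra `SV` of `V`. Mathlib equips it with the coproduct that
makes every `v ∈ V` primitive, i.e. the one induced by the diagonal map `V → V ⊕ V`. -/
abbrev Sym : Type u := SymmetricAlgebra ℂ V

/-- The full antidual `SV'`: all antilinear functionals `SV → ℂ`. -/
def Antidual : Type u := Sym V →ₛₗ[starRingEnd ℂ] ℂ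

variable {V}

namespace Antidual

instance : AddCommGroup (Antidual V) :=
  inferInstanceAs (AddCommGroup (Sym V →ₛₗ[starRingEnd ℂ] ℂ))

instance : Module ℂ (Antidual V) :=
  inferInstanceAs (Module ℂ (Sym V →ₛₗ[starRingEnd ℂ] ℂ))

instance : FunLike (Antidual V) (Sym V) ℂ :=
  inferInstanceAs (FunLike (Sym V →ₛₗ[starRingEnd ℂ] ℂ) (Sym V) ℂ)

instance : SemilinearMapClass (Antidual V) (starRingEnd ℂ) (Sym V) ℂ :=
  inferInstanceAs
    (SemilinearMapClass (Sym V →ₛₗ[starRingEnd ℂ] ℂ) (starRingEnd ℂ) (Sym V) ℂ)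

@[ext] theorem ext {Φ Ψ : Antidual V} (h : ∀ ψ, Φ ψ = Ψ ψ) : Φ = Ψ := DFunLike.ext _ _ h

@[simp] theorem add_apply (Φ Ψ : Antidual V) (ψ : Sym V) : (Φ + Ψ) ψ = Φ ψ + Ψ ψ := rfl
@[simp] theorem zero_apply (ψ : Sym V) : (0 : Antidual V) ψ = 0 := rfl
@[simp] theorem smul_apply (c : ℂ) (Φ : Antidual V) (ψ : Sym V) : (c • Φ) ψ = c * Φ ψ := rfl

/-- The antilinear functional `ψ ↦ conj (f ψ)` attached to a linear functional `f` on `SV`. -/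
def ofLinear (f : Sym V →ₗ[ℂ] ℂ) : Antidual V where
  toFun ψ := conj (f ψ)
  map_add' x y := by simp
  map_smul' c x := by simp

/-- The linear functional `ψ ↦ conj (Φ ψ)` attached to an antilinear functional `Φ` on `SV`. -/
def toLinear (Φ : Antidual V) : Sym V →ₗ[ℂ] ℂ where
  toFun ψ := conj (Φ ψ)
  map_add' x y := by simp
  map_smul' c x := by simp [map_smulₛₗ]

@[simp] theorem ofLinear_apply (f : Sym V →ₗ[ℂ] ℂ) (ψ : Sym V) : ofLinear f ψ = conj (f ψ) := rfl
@[simp] theorem toLinear_apply (Φ : Antidual V) (ψ : Sym V) : toLinear Φ ψ = conj (Φ ψ) := rfl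

/-- The product of `SV'`: `[ΦΨ](θ) = [Φ ⊗ Ψ](Δθ)`. As `Φ` and `Ψ` are antilinear, `Φ ⊗ Ψ` is
written as the complex conjugate of the tensor product of two linear functionals. -/
instance : Mul (Antidual V) where
  mul Φ Ψ := ofLinear
    (LinearMap.mul' ℂ ℂ ∘ₗ TensorProduct.map (toLinear Φ) (toLinear Ψ) ∘ₗ
      Coalgebra.comul (R := ℂ) (A := Sym V))

theorem mul_def (Φ Ψ : Antidual V) (θ : Sym V) :
    (Φ * Ψ) θ = conj (LinearMap.mul' ℂ ℂ
      (TensorProduct.map (toLinear Φ) (toLinear Ψ) (Coalgebra.comul (R := ℂ) θ))) := rfl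

/-- `[ΦΨ](θ) = ∑ₖ Φ(ξₖ) Ψ(ηₖ)` when `Δθ = ∑ₖ ξₖ ⊗ ηₖ`. -/
theorem mul_apply_of_comul_eq {ι : Type*} (s : Finset ι) (ξ η : ι → Sym V) (θ : Sym V)
    (h : Coalgebra.comul (R := ℂ) θ = ∑ k ∈ s, ξ k ⊗ₜ[ℂ] η k) (Φ Ψ : Antidual V) :
    (Φ * Ψ) θ = ∑ k ∈ s, Φ (ξ k) * Ψ (η k) := by
  simp [mul_def, h]

/-- The unit of `SV'`: the counit of `SV`, conjugated, i.e. `⟨· | 1⟩`. -/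
instance : One (Antidual V) where
  one := ofLinear (Coalgebra.counit (R := ℂ) (A := Sym V))

theorem one_def (θ : Sym V) : (1 : Antidual V) θ = conj (Coalgebra.counit (R := ℂ) θ) := rfl

def toC (Φ : Antidual V) : WithConv (Sym V →ₗ[ℂ] ℂ) := WithConv.toConv (toLinear Φ)

theorem toC_inj {Φ Ψ : Antidual V} (h : toC Φ = toC Ψ) : Φ = Ψ := by
  have h' : toLinear Φ = toLinear Ψ := WithConv.toConv_injective h
  ext ψ
  exact (starRingEnd ℂ).injective (LinearMap.congr_fun h' ψ)

theorem toC_mul (Φ Ψ : Antidual V) : toC (Φ * Ψ) = toC Φ * toC Ψ := by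
  apply WithConv.ext
  ext θ
  simp [toC, mul_def, LinearMap.convMul_def]

theorem toC_one : toC (1 : Antidual V) = 1 := by
  apply WithConv.ext
  ext θ
  simp [toC, one_def, LinearMap.convOne_def]

theorem toC_add (Φ Ψ : Antidual V) : toC (Φ + Ψ) = toC Φ + toC Ψ := by
  apply WithConv.ext
  ext θ
  simp [toC]

theorem toC_zero : toC (0 : Antidual V) = 0 := by
  apply WithConv.ext
  ext θ
  simp [toC]

instance : CommRing (Antidual V) where
  __ := (inferInstance : AddCommGroup (Antidual V))
  left_distrib a b c := toC_inj (by simp only [toC_mul, toC_add, mul_add])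
  right_distrib a b c := toC_inj (by simp only [toC_mul, toC_add, add_mul])
  zero_mul a := toC_inj (by simp only [toC_mul, toC_zero, zero_mul])
  mul_zero a := toC_inj (by simp only [toC_mul, toC_zero, mul_zero])
  mul_assoc a b c := toC_inj (by simp only [toC_mul, mul_assoc])
  one_mul a := toC_inj (by simp only [toC_mul, toC_one, one_mul])
  mul_one a := toC_inj (by simp only [toC_mul, toC_one, mul_one])
  mul_comm a b := toC_inj (by simp only [toC_mul, mul_comm])

theorem toLinear_smul (c : ℂ) (Φ : Antidual V) :
    toLinear (c • Φ) = conj c • toLinear Φ := by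
  ext θ
  simp

instance : Algebra ℂ (Antidual V) :=
  Algebra.ofModule
    (fun c Φ Ψ => by
      ext θ
      simp [mul_def, toLinear_smul, TensorProduct.map_smul_left])
    (fun c Φ Ψ => by
      ext θ
      simp [mul_def, toLinear_smul, TensorProduct.map_smul_right])

end Antidual

/-! ### Creators and annihilators -/

/-- The creator `c(v) : SV → SV`, multiplication by `v`. -/
def create (v : V) : Sym V →ₗ[ℂ] Sym V :=
  LinearMap.mulLeft ℂ (SymmetricAlgebra.ι ℂ V v)

theorem create_apply (v : V) (φ : Sym V) : create v φ = SymmetricAlgebra.ι ℂ V v * φ := rfl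

/-- The algebra map `SV → SV[ε]`, `w ↦ w + ⟨v | w⟩ ε`, whose `ε`-part is the annihilator. -/
def annihilateAux (v : V) : Sym V →ₐ[ℂ] TrivSqZeroExt (Sym V) (Sym V) :=
  SymmetricAlgebra.lift
    ((TrivSqZeroExt.inlAlgHom ℂ (Sym V) (Sym V)).toLinearMap ∘ₗ SymmetricAlgebra.ι ℂ V +
      (TrivSqZeroExt.inrHom (Sym V) (Sym V)).restrictScalars ℂ ∘ₗ
        Algebra.linearMap ℂ (Sym V) ∘ₗ (innerSL ℂ v).toLinearMap)

theorem annihilateAux_fst (v : V) (φ : Sym V) : (annihilateAux v φ).fst = φ := by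
  have h : (TrivSqZeroExt.fstHom ℂ (Sym V) (Sym V)).comp (annihilateAux v) =
      AlgHom.id ℂ (Sym V) := by
    ext w
    simp [annihilateAux]
  exact congr($h φ)

/-- The annihilator `a(v) : SV → SV`: the linear derivation with `a(v) w = ⟨v | w⟩` for `w ∈ V`. -/
def annihilate (v : V) : Derivation ℂ (Sym V) (Sym V) :=
  Derivation.mk'
    ((TrivSqZeroExt.sndHom (Sym V) (Sym V)).restrictScalars ℂ ∘ₗ (annihilateAux v).toLinearMap)
    (fun a b => by simp [annihilateAux_fst, mul_comm b])

@[simp] theorem annihilate_ι (v w : V) :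
    annihilate v (SymmetricAlgebra.ι ℂ V w) = algebraMap ℂ (Sym V) ⟪v, w⟫_ℂ := by
  simp [annihilate, annihilateAux, Algebra.algebraMap_eq_smul_one]

namespace Antidual

/-- The creator on `SV'`, by antiduality: `[c(v)Φ](ψ) = Φ(a(v)ψ)`. -/
def create (v : V) : Antidual V →ₗ[ℂ] Antidual V where
  toFun Φ := LinearMap.comp (Φ : Sym V →ₛₗ[starRingEnd ℂ] ℂ) (annihilate v).toLinearMap
  map_add' _ _ := rfl
  map_smul' _ _ := rfl

/-- The annihilator on `SV'`, by antiduality: `[a(v)Φ](ψ) = Φ(c(v)ψ)`. -/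
def annihilate (v : V) : Antidual V →ₗ[ℂ] Antidual V where
  toFun Φ := LinearMap.comp (Φ : Sym V →ₛₗ[starRingEnd ℂ] ℂ) (BosonicFock.create v)
  map_add' _ _ := rfl
  map_smul' _ _ := rfl

@[simp] theorem create_apply (v : V) (Φ : Antidual V) (ψ : Sym V) :
    create v Φ ψ = Φ (BosonicFock.annihilate v ψ) := rfl

@[simp] theorem annihilate_apply (v : V) (Φ : Antidual V) (ψ : Sym V) :
    annihilate v Φ ψ = Φ (SymmetricAlgebra.ι ℂ V v * ψ) := rfl

/-- The annihilator is a derivation of the algebra `SV'`. -/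
theorem annihilate_mul (v : V) (Φ Ψ : Antidual V) :
    annihilate v (Φ * Ψ) = annihilate v Φ * Ψ + Φ * annihilate v Ψ := by
  ext θ
  simp only [annihilate_apply, add_apply, mul_def, Bialgebra.comul_mul,
    SymmetricAlgebra.comul_ι, ← map_add]
  congr 1
  generalize Coalgebra.comul (R := ℂ) θ = t
  induction t with
  | zero => simp
  | tmul a b => simp [add_mul]
  | add s t hs ht => simp only [mul_add, map_add, hs, ht]; ring

theorem annihilate_pow_succ (v : V) (Φ : Antidual V) (n : ℕ) :
    annihilate v (Φ ^ (n + 1)) = (n + 1 : ℂ) • (Φ ^ n * annihilate v Φ) := by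
  induction n with
  | zero => simp
  | succ n ih =>
    rw [pow_succ, annihilate_mul, ih, Algebra.smul_mul_assoc, pow_succ]
    have h : Φ ^ n * annihilate v Φ * Φ = Φ ^ n * Φ * annihilate v Φ := by ring
    rw [h]
    push_cast
    module

theorem mul_one_apply (Φ Ψ : Antidual V) : (Φ * Ψ) 1 = Φ 1 * Ψ 1 := by
  simp [mul_def, Algebra.TensorProduct.one_def]

/-! ### Exponentials in `SV'` -/

theorem exists_pow_mul_eq_zero {ζ : Antidual V} (h : ζ 1 = 0) (ψ : Sym V) :
    ∃ N : ℕ, ∀ n ≥ N, ∀ Ψ : Antidual V, (ζ ^ n * Ψ) ψ = 0 := by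
  have key : ∀ x ψ : Sym V, (∃ N : ℕ, ∀ n ≥ N, ∀ Ψ : Antidual V, (ζ ^ n * Ψ) ψ = 0) →
      ∃ N : ℕ, ∀ n ≥ N, ∀ Ψ : Antidual V, (ζ ^ n * Ψ) (x * ψ) = 0 := by
    intro x
    induction x using SymmetricAlgebra.induction with
    | algebraMap r =>
      rintro ψ ⟨N, hN⟩
      refine ⟨N, fun n hn Ψ => ?_⟩
      rw [← Algebra.smul_def, map_smulₛₗ, hN n hn, smul_zero]
    | ι v =>
      rintro ψ ⟨N, hN⟩
      refine ⟨N + 1, fun n hn Ψ => ?_⟩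
      obtain ⟨m, rfl⟩ : ∃ m, n = m + 1 := ⟨n - 1, by omega⟩
      rw [← annihilate_apply, annihilate_mul, annihilate_pow_succ, add_apply,
        hN (m + 1) (by omega), Algebra.smul_mul_assoc, smul_apply, mul_assoc, hN m (by omega)]
      simp
    | mul a b ha hb =>
      intro ψ hψ
      rw [mul_assoc]
      exact ha _ (hb _ hψ)
    | add a b ha hb =>
      intro ψ hψ
      obtain ⟨N, hN⟩ := ha ψ hψ
      obtain ⟨M, hM⟩ := hb ψ hψ
      refine ⟨max N M, fun n hn Ψ => ?_⟩
      rw [add_mul, map_add, hN n (le_trans (le_max_left _ _) hn),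
        hM n (le_trans (le_max_right _ _) hn), add_zero]
  rw [← mul_one ψ]
  refine key ψ 1 ⟨1, fun n hn Ψ => ?_⟩
  obtain ⟨m, rfl⟩ : ∃ m, n = m + 1 := ⟨n - 1, by omega⟩
  rw [pow_succ, mul_one_apply, mul_one_apply, h]
  simp

theorem finite_support_pow {ζ : Antidual V} (h : ζ 1 = 0) (ψ : Sym V) :
    (Function.support fun n : ℕ => (n.factorial : ℂ)⁻¹ * (ζ ^ n) ψ).Finite := by
  obtain ⟨N, hN⟩ := exists_pow_mul_eq_zero h ψ
  refine (Set.finite_lt_nat N).subset fun n hn => ?_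
  by_contra hlt
  refine hn ?_
  have := hN n (not_lt.mp hlt) 1
  rw [mul_one] at this
  simp [this]

/-- The exponential `exp ζ = ∑ₙ ζⁿ / n!` in `SV'` of a functional `ζ` without constant term; on each
element of `SV` only finitely many terms of the series are nonzero. -/
def exp (ζ : Antidual V) (h : ζ 1 = 0) : Antidual V where
  toFun ψ := ∑ᶠ n : ℕ, (n.factorial : ℂ)⁻¹ * (ζ ^ n) ψ
  map_add' x y := by
    rw [← finsum_add_distrib (finite_support_pow h x) (finite_support_pow h y)]
    simp [mul_add]
  map_smul' c x := by
    rw [smul_eq_mul, mul_finsum' _ _ (finite_support_pow h x)]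
    refine finsum_congr fun n => ?_
    rw [map_smulₛₗ, smul_eq_mul]
    ring

/-- The exponential series converges weakly. -/
theorem hasSum_exp (ζ : Antidual V) (h : ζ 1 = 0) (ψ : Sym V) :
    HasSum (fun n : ℕ => (n.factorial : ℂ)⁻¹ * (ζ ^ n) ψ) (exp ζ h ψ) := by
  have hs := finite_support_pow h ψ
  have : exp ζ h ψ = ∑ᶠ n : ℕ, (n.factorial : ℂ)⁻¹ * (ζ ^ n) ψ := rfl
  rw [this, finsum_eq_sum _ hs]
  exact hasSum_sum_of_ne_finset_zero fun n hn => by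
    rwa [Set.Finite.mem_toFinset, Function.notMem_support] at hn

end Antidual

/-! ### Quadratics and Gaussians -/

/-- The projection `P¹ : SV → S¹V = V`. -/
def degreeOne : Sym V →ₗ[ℂ] V :=
  letI : Module ℂᵐᵒᵖ V := Module.compHom V ((RingHom.id ℂ).fromOpposite mul_comm)
  haveI : IsCentralScalar ℂ V := ⟨fun _ _ => rfl⟩
  TrivSqZeroExt.sndHom ℂ V ∘ₗ
    (SymmetricAlgebra.lift (TrivSqZeroExt.inrHom ℂ V) :
      Sym V →ₐ[ℂ] TrivSqZeroExt ℂ V).toLinearMap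

theorem degreeOne_ι (v : V) : degreeOne (SymmetricAlgebra.ι ℂ V v) = v := by
  simp [degreeOne]

theorem degreeOne_one : degreeOne (1 : Sym V) = 0 := by
  let : Module ℂᵐᵒᵖ V := Module.compHom V ((RingHom.id ℂ).fromOpposite mul_comm)
  have : IsCentralScalar ℂ V := ⟨fun _ _ => rfl⟩
  have h : (SymmetricAlgebra.lift (TrivSqZeroExt.inrHom ℂ V) :
      Sym V →ₐ[ℂ] TrivSqZeroExt ℂ V) 1 = 1 := map_one _
  simp [degreeOne, h]

theorem degreeOne_ι_mul (v : V) (ψ : Sym V) :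
    degreeOne (SymmetricAlgebra.ι ℂ V v * ψ) = Coalgebra.counit (R := ℂ) ψ • v := by
  let : Module ℂᵐᵒᵖ V := Module.compHom V ((RingHom.id ℂ).fromOpposite mul_comm)
  have : IsCentralScalar ℂ V := ⟨fun _ _ => rfl⟩
  have h : (TrivSqZeroExt.fstHom ℂ ℂ V).comp
      (SymmetricAlgebra.lift (TrivSqZeroExt.inrHom ℂ V) : Sym V →ₐ[ℂ] TrivSqZeroExt ℂ V) =
      Bialgebra.counitAlgHom ℂ (Sym V) := by
    ext w
    simp [SymmetricAlgebra.algebraMapInv_ι]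
  have h' := congr($h ψ)
  simp only [AlgHom.comp_apply, TrivSqZeroExt.fstHom_apply, Bialgebra.counitAlgHom_apply] at h'
  simp [degreeOne, h']

/-- An antilinear map `Z : V → V` is symmetric when `⟨y | Zx⟩ = ⟨x | Zy⟩` for all `x, y`. -/
def IsSymmetricAnti (Z : V →SL[starRingEnd ℂ] V) : Prop :=
  ∀ x y : V, ⟪y, Z x⟫_ℂ = ⟪x, Z y⟫_ℂ

/-- `Z : V → V` is of Hilbert–Schmidt class: `∑ᵢ ‖Z bᵢ‖² < ∞` for a Hilbert basis `b` of `V`. -/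
def IsHilbertSchmidt (Z : V →SL[starRingEnd ℂ] V) : Prop :=
  ∃ (s : Set V) (b : HilbertBasis s ℂ V), Summable fun i : s => ‖Z (b i)‖ ^ 2

/-- The bilinear form `(x, y) ↦ ⟨Zx | y⟩` on `V`, as a linear functional on `V ⊗ V`. -/
def formOf (Z : V →SL[starRingEnd ℂ] V) : V ⊗[ℂ] V →ₗ[ℂ] ℂ :=
  TensorProduct.lift
    (LinearMap.mk₂ ℂ (fun x y : V => ⟪Z x, y⟫_ℂ)
      (fun x x' y => by simp)
      (fun c x y => by simp [mul_comm])
      (fun x y y' => by simp)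
      (fun c x y => by simp))

@[simp] theorem formOf_tmul (Z : V →SL[starRingEnd ℂ] V) (x y : V) :
    formOf Z (x ⊗ₜ y) = ⟪Z x, y⟫_ℂ := by
  simp [formOf]

/-- The quadratic `ζ ∈ S²V'` that corresponds to a symmetric antilinear map `Z : V → V`: the
functional of homogeneous degree two such that `ζ(xy) = ⟨y | Zx⟩`
(see `quadratic_ι_mul_ι` and `quadratic_prod_of_ne_two`). -/
def quadratic (Z : V →SL[starRingEnd ℂ] V) : Antidual V :=
  Antidual.ofLinear ((2⁻¹ : ℂ) •
    (formOf Z ∘ₗ TensorProduct.map degreeOne degreeOne ∘ₗ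
      Coalgebra.comul (R := ℂ) (A := Sym V)))

theorem quadratic_one (Z : V →SL[starRingEnd ℂ] V) : quadratic Z 1 = 0 := by
  simp [quadratic, Algebra.TensorProduct.one_def, degreeOne_one]

theorem quadratic_ι_mul {Z : V →SL[starRingEnd ℂ] V} (hZ : IsSymmetricAnti Z) (v : V)
    (ψ : Sym V) : quadratic Z (SymmetricAlgebra.ι ℂ V v * ψ) = ⟪degreeOne ψ, Z v⟫_ℂ := by
  have h1 : ∀ t : Sym V ⊗[ℂ] Sym V,
      TensorProduct.map degreeOne degreeOne ((SymmetricAlgebra.ι ℂ V v ⊗ₜ[ℂ] 1) * t) =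
        v ⊗ₜ[ℂ] degreeOne (TensorProduct.lid ℂ (Sym V)
          (LinearMap.rTensor (Sym V) (Coalgebra.counit (R := ℂ)) t)) := by
    intro t
    induction t with
    | zero => simp
    | tmul a b => simp [degreeOne_ι_mul, TensorProduct.smul_tmul]
    | add s t hs ht => simp only [mul_add, map_add, hs, ht, TensorProduct.tmul_add]
  have h2 : ∀ t : Sym V ⊗[ℂ] Sym V,
      TensorProduct.map degreeOne degreeOne ((1 ⊗ₜ[ℂ] SymmetricAlgebra.ι ℂ V v) * t) =
        degreeOne (TensorProduct.rid ℂ (Sym V)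
          (LinearMap.lTensor (Sym V) (Coalgebra.counit (R := ℂ)) t)) ⊗ₜ[ℂ] v := by
    intro t
    induction t with
    | zero => simp
    | tmul a b => simp [degreeOne_ι_mul, TensorProduct.smul_tmul]
    | add s t hs ht => simp only [mul_add, map_add, hs, ht, TensorProduct.add_tmul]
  have h3 : ⟪Z (degreeOne ψ), v⟫_ℂ = ⟪Z v, degreeOne ψ⟫_ℂ := by
    rw [← inner_conj_symm, hZ, inner_conj_symm]
  simp only [quadratic, Antidual.ofLinear_apply, LinearMap.smul_apply, LinearMap.comp_apply,
    Bialgebra.comul_mul, SymmetricAlgebra.comul_ι, add_mul, map_add, h1, h2,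
    Coalgebra.rTensor_counit_comul, Coalgebra.lTensor_counit_comul, TensorProduct.lid_tmul,
    TensorProduct.rid_tmul, one_smul, formOf_tmul, h3]
  rw [← inner_conj_symm (degreeOne ψ) (Z v)]
  congr 1
  simp only [smul_eq_mul]
  ring

theorem quadratic_ι_mul_ι {Z : V →SL[starRingEnd ℂ] V} (hZ : IsSymmetricAnti Z) (x y : V) :
    quadratic Z (SymmetricAlgebra.ι ℂ V x * SymmetricAlgebra.ι ℂ V y) = ⟪y, Z x⟫_ℂ := by
  rw [quadratic_ι_mul hZ, degreeOne_ι]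

theorem quadratic_prod_of_ne_two {Z : V →SL[starRingEnd ℂ] V} (hZ : IsSymmetricAnti Z) {n : ℕ}
    (hn : n ≠ 2) (x : Fin n → V) :
    quadratic Z (∏ i, SymmetricAlgebra.ι ℂ V (x i)) = 0 := by
  match n, x with
  | 0, x => simp [quadratic_one]
  | 1, x => simpa [degreeOne_one] using quadratic_ι_mul hZ (x 0) 1
  | 2, x => exact absurd rfl hn
  | n + 3, x =>
    rw [Fin.prod_univ_succ, quadratic_ι_mul hZ, Fin.prod_univ_succ, degreeOne_ι_mul,
      Fin.prod_univ_succ]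
    simp

/-- The Gaussian `e^Z = exp ζ ∈ SV'`, with `ζ` the quadratic corresponding to `Z`. -/
def gaussian (Z : V →SL[starRingEnd ℂ] V) : Antidual V :=
  Antidual.exp (quadratic Z) (quadratic_one Z)

/-! ### The inner product of `SV` and symmetric Fock space -/

/-- The functional `⟨· | v⟩` on `SV` for `v ∈ V`, i.e. `ψ ↦ ⟨P¹ψ | v⟩`. -/
def ket : V →ₗ[ℂ] Antidual V where
  toFun v := Antidual.ofLinear ((innerSL ℂ v).toLinearMap ∘ₗ degreeOne)
  map_add' v w := by ext ψ; simp
  map_smul' c v := by ext ψ; simp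

@[simp] theorem ket_apply (v : V) (ψ : Sym V) : ket v ψ = ⟪degreeOne ψ, v⟫_ℂ := by
  simp [ket]

/-- The canonical inclusion `SV → SV'`, `φ ↦ ⟨· | φ⟩`, an algebra homomorphism. -/
def incl : Sym V →ₐ[ℂ] Antidual V := SymmetricAlgebra.lift ket

/-- The standard inner product `⟨φ | ψ⟩` of `SV`, antilinear in `φ` and linear in `ψ`
(see `symInner_prod` and `symInner_prod_of_ne` for the formula with permanents). -/
def symInner (φ ψ : Sym V) : ℂ := incl ψ φ

theorem incl_apply (φ ψ : Sym V) : incl φ ψ = symInner ψ φ := rfl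

theorem annihilate_ket (v w : V) :
    Antidual.annihilate v (ket w) = algebraMap ℂ (Antidual V) ⟪v, w⟫_ℂ := by
  ext ψ
  rw [Algebra.algebraMap_eq_smul_one]
  simp only [Antidual.annihilate_apply, ket_apply, degreeOne_ι_mul, inner_smul_left,
    Antidual.smul_apply, Antidual.one_def]
  ring

theorem annihilate_prod {ι : Type*} [DecidableEq ι] (v : V) (y : ι → V) (s : Finset ι) :
    Antidual.annihilate v (∏ j ∈ s, ket (y j)) =
      ∑ j ∈ s, ⟪v, y j⟫_ℂ • ∏ i ∈ s.erase j, ket (y i) := by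
  induction s using Finset.induction_on with
  | empty =>
    ext ψ
    simp [Antidual.one_def]
  | insert a s ha ih =>
    rw [Finset.prod_insert ha, Antidual.annihilate_mul, ih, annihilate_ket,
      Finset.sum_insert ha, Finset.erase_insert ha, ← Algebra.smul_def, Finset.mul_sum]
    congr 1
    refine Finset.sum_congr rfl fun j hj => ?_
    have hja : a ≠ j := fun h => ha (h ▸ hj)
    rw [Finset.erase_insert_of_ne hja, Finset.prod_insert (fun h => ha (Finset.mem_of_mem_erase h)),
      mul_smul_comm]

theorem annihilate_prod_fin (v : V) {n : ℕ} (y : Fin (n + 1) → V) :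
    Antidual.annihilate v (∏ j, ket (y j)) =
      ∑ j, ⟪v, y j⟫_ℂ • ∏ k : Fin n, ket (y (Equiv.swap 0 j k.succ)) := by
  rw [annihilate_prod]
  refine Finset.sum_congr rfl fun j _ => ?_
  congr 1
  have h : Finset.univ.erase j =
      (Finset.univ : Finset (Fin n)).map
        ((Fin.succEmb n).trans (Equiv.swap 0 j).toEmbedding) := by
    ext i
    simp only [Finset.mem_erase, Finset.mem_univ, and_true, Finset.mem_map, true_and,
      Function.Embedding.trans_apply, Equiv.coe_toEmbedding, Fin.coe_succEmb]
    constructor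
    · intro hi
      have : Equiv.swap 0 j i ≠ 0 := by
        rw [Ne, Equiv.swap_apply_eq_iff, Equiv.swap_apply_left]
        exact hi
      obtain ⟨k, hk⟩ := Fin.exists_succ_eq.mpr this
      exact ⟨k, by rw [hk, Equiv.swap_apply_self]⟩
    · rintro ⟨k, rfl⟩ hk
      rw [Equiv.swap_apply_eq_iff, Equiv.swap_apply_right] at hk
      exact Fin.succ_ne_zero k hk
  rw [h, Finset.prod_map]
  rfl

theorem incl_prod {n : ℕ} (y : Fin n → V) :
    incl (∏ j, SymmetricAlgebra.ι ℂ V (y j)) = ∏ j, ket (y j) := by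
  simp [incl, map_prod]

/-- `⟨x₁ ⋯ x_d | y₁ ⋯ y_d⟩ = Per [⟨x_a | y_b⟩]`. -/
theorem symInner_prod {d : ℕ} (x y : Fin d → V) :
    symInner (∏ i, SymmetricAlgebra.ι ℂ V (x i)) (∏ j, SymmetricAlgebra.ι ℂ V (y j)) =
      (Matrix.of fun a b => ⟪x a, y b⟫_ℂ).permanent := by
  rw [symInner, incl_prod, ← Matrix.permanent_transpose]
  induction d with
  | zero => simp [Antidual.one_def, Matrix.permanent]
  | succ d ih =>
    rw [Fin.prod_univ_succ (fun i => SymmetricAlgebra.ι ℂ V (x i)), ← Antidual.annihilate_apply, annihilate_prod_fin,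
      Matrix.permanent, ← Equiv.Perm.decomposeFin.symm.sum_comp, Fintype.sum_prod_type]
    have hsum : ∀ (s : Finset (Fin (d + 1))) (f : Fin (d + 1) → Antidual V) (ψ : Sym V),
        (∑ j ∈ s, f j) ψ = ∑ j ∈ s, f j ψ := fun s f ψ =>
      map_sum ({ toFun := fun Φ => Φ ψ, map_zero' := rfl, map_add' := fun _ _ => rfl } :
        Antidual V →+ ℂ) f s
    rw [hsum]
    refine Finset.sum_congr rfl fun j _ => ?_
    rw [Antidual.smul_apply, ih (fun i => x i.succ) (fun k => y (Equiv.swap 0 j k.succ)),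
      Matrix.permanent, Finset.mul_sum]
    refine Finset.sum_congr rfl fun e _ => ?_
    simp [Fin.prod_univ_succ]

/-- Homogeneous summands of different degrees are perpendicular. -/
theorem symInner_prod_of_ne {m n : ℕ} (h : m ≠ n) (x : Fin m → V) (y : Fin n → V) :
    symInner (∏ i, SymmetricAlgebra.ι ℂ V (x i)) (∏ j, SymmetricAlgebra.ι ℂ V (y j)) = 0 := by
  rw [symInner, incl_prod]
  induction m generalizing n with
  | zero =>
    obtain ⟨k, rfl⟩ := Nat.exists_eq_succ_of_ne_zero h.symm
    rw [Fin.prod_univ_succ (fun j => ket (y j))]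
    simp [Antidual.mul_one_apply, degreeOne_one]
  | succ m ih =>
    rw [Fin.prod_univ_succ (fun i => SymmetricAlgebra.ι ℂ V (x i)), ← Antidual.annihilate_apply]
    match n, y with
    | 0, y => simp [Antidual.one_def]
    | n + 1, y =>
      rw [annihilate_prod_fin]
      have hsum : ∀ (s : Finset (Fin (n + 1))) (f : Fin (n + 1) → Antidual V) (ψ : Sym V),
          (∑ j ∈ s, f j) ψ = ∑ j ∈ s, f j ψ := fun s f ψ =>
        map_sum ({ toFun := fun Φ => Φ ψ, map_zero' := rfl, map_add' := fun _ _ => rfl } :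
          Antidual V →+ ℂ) f s
      rw [hsum]
      refine Finset.sum_eq_zero fun j _ => ?_
      rw [Antidual.smul_apply, ih (by omega) (fun i => x i.succ), mul_zero]

/-- The norm of `SV`. -/
def symNorm (ψ : Sym V) : ℝ := √(symInner ψ ψ).re

/-- The operator norm `‖Φ‖ ∈ [0, ∞]` of an antilinear functional on the inner product space `SV`. -/
def fockNorm (Φ : Antidual V) : ℝ≥0∞ :=
  ⨆ (ψ : Sym V) (_ : symNorm ψ ≤ 1), ‖Φ ψ‖ₑ

variable (V) in
/-- Symmetric Fock space `S[V]`, realized as the space of bounded antilinear functionals on `SV`. -/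
def fockSpace : Set (Antidual V) := {Φ | fockNorm Φ < ∞}

/-! ### Polynomials in creators and annihilators, as operators in `S[V]` -/

variable (V) in
/-- The letters `c(v)` and `a(v)`, for `v ∈ V`. -/
inductive Letter : Type u
  | c (v : V) : Letter
  | a (v : V) : Letter

/-- The operator on `SV'` that a letter stands for. -/
def Letter.op : Letter V → Antidual V →ₗ[ℂ] Antidual V
  | .c v => Antidual.create v
  | .a v => Antidual.annihilate v

/-- The natural domain of a creator or annihilator `A` as an operator in `S[V]`. -/
def Letter.domain (A : Letter V) : Set (Antidual V) :=
  {Φ | Φ ∈ fockSpace V ∧ A.op Φ ∈ fockSpace V}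

/-- The product `A₁ A₂ ⋯ Aₙ` of creators and annihilators on `SV'`. -/
def wordOp : List (Letter V) → Antidual V →ₗ[ℂ] Antidual V
  | [] => LinearMap.id
  | A :: w => A.op ∘ₗ wordOp w

/-- The domain of the product `A₁ A₂ ⋯ Aₙ` of operators in `S[V]`: inductively, `Φ` has to lie in
the domain of `A₂ ⋯ Aₙ` and `A₂ ⋯ Aₙ Φ` in the domain of `A₁`. -/
def wordDomain : List (Letter V) → Set (Antidual V)
  | [] => fockSpace V
  | A :: w => {Φ | Φ ∈ wordDomain w ∧ wordOp w Φ ∈ A.domain}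

variable (V) in
/-- Polynomials in creators and annihilators: noncommutative polynomials, given by their finitely
many nonzero coefficients. -/
abbrev CAPolynomial : Type u := List (Letter V) →₀ ℂ

/-- The operator `∑_w p_w w` on `SV'`. -/
def CAPolynomial.op (p : CAPolynomial V) : Antidual V →ₗ[ℂ] Antidual V :=
  p.sum fun w r => r • wordOp w

/-- The domain of `∑_w p_w w` as an operator in `S[V]`: the intersection of the domains of the
products `w` that occur in it. -/
def CAPolynomial.domain (p : CAPolynomial V) : Set (Antidual V) :=
  {Φ | Φ ∈ fockSpace V ∧ ∀ w ∈ p.support, Φ ∈ wordDomain w}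

end BosonicFock

end

noncomputable section

namespace BosonicFock

universe u

variable {V : Type u} [NormedAddCommGroup V] [InnerProductSpace ℂ V]

open SymmetricAlgebra (ι)

/-! The space of vectors `φ e^Z` with `φ ∈ SV` is stable under all creators and annihilators: `c(v)`
is multiplication by `v` (`Antidual.create_eq_ket_mul`), and `a(v)` is a derivation with `a(v) e^Z =
(Zv) e^Z` (`annihilate_gaussian`). So every claim about domains reduces to `φ e^Z ∈ S[V]`, which is
`incl_mul_gaussian_mem_fockSpace`.

For the latter, a given `ψ ∈ SV` involves only a finite-dimensional `M ⊆ V` with orthonormal basis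
`e`. On `SM` the functional `ζ` agrees with an honest element of `S²V`, the quadratic of `PZP`
(`agreeOn_quadratic`). Hence the `k`-th term of `(φ e^Z)(ψ)` is `⟨ψ | φ gₖ⟩` with `gₖ = gaussTerm e
Z k`, and Cauchy–Schwarz applies once the inner product is known to be positive semidefinite
(`symInner_eq_sum_gramTerm`).

It remains to bound `‖φ gₖ‖` summably in `k` and uniformly in `e`. Multiplication by `φ` costs only
a power of the degree `2k` (`exists_symNorm_mul_le`). Euler's identity and the commutation relations
bound `‖gₖ‖²` by a sequence with ratios `r + T / (2(k + 1))`, where `‖Z‖² ≤ r < 1` and `T` comes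
from the Hilbert–Schmidt norm (`symNorm_gaussTerm_sq_le`). The ratios tend to `r`, so the decay is
geometric. -/

/-! ### The subalgebra generated by a subspace -/

/-- The subalgebra `SM` of `SV` generated by a subspace `M` of `V`. -/
def symOf (M : Submodule ℂ V) : Subalgebra ℂ (Sym V) := Algebra.adjoin ℂ (ι ℂ V '' M)

theorem ι_mem_symOf {M : Submodule ℂ V} {v : V} (hv : v ∈ M) : ι ℂ V v ∈ symOf M :=
  Algebra.subset_adjoin ⟨v, hv, rfl⟩

theorem symOf_mono {M N : Submodule ℂ V} (h : M ≤ N) : symOf M ≤ symOf N :=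
  Algebra.adjoin_mono (Set.image_mono h)

/-- Multiplying by one vector at a time is the step suited to functionals, because `Φ(vψ) =
(a(v)Φ)(ψ)`. -/
theorem symOf_induction {M : Submodule ℂ V} {p : Sym V → Prop} (one : p 1)
    (smul : ∀ (c : ℂ) ψ, p ψ → p (c • ψ)) (add : ∀ φ ψ, p φ → p ψ → p (φ + ψ))
    (ι_mul : ∀ v ∈ M, ∀ ψ, p ψ → p (ι ℂ V v * ψ)) {ψ : Sym V} (hψ : ψ ∈ symOf M) : p ψ := by
  have key : ∀ ψ ∈ symOf M, ∀ χ, p χ → p (ψ * χ) := by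
    intro ψ hψ
    induction hψ using Algebra.adjoin_induction with
    | mem x hx =>
      obtain ⟨v, hv, rfl⟩ := hx
      exact ι_mul v hv
    | algebraMap r =>
      intro χ hχ
      rw [← Algebra.smul_def]
      exact smul r χ hχ
    | add x y _ _ hx hy =>
      intro χ hχ
      rw [add_mul]
      exact add _ _ (hx χ hχ) (hy χ hχ)
    | mul x y _ _ hx hy =>
      intro χ hχ
      rw [mul_assoc]
      exact hx _ (hy χ hχ)
  simpa using key ψ hψ 1 one

theorem mem_symOf_top (ψ : Sym V) : ψ ∈ symOf (⊤ : Submodule ℂ V) := by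
  induction ψ using SymmetricAlgebra.induction with
  | algebraMap r => exact Subalgebra.algebraMap_mem _ r
  | ι v => exact ι_mem_symOf trivial
  | mul a b ha hb => exact mul_mem ha hb
  | add a b ha hb => exact add_mem ha hb

theorem sym_induction {p : Sym V → Prop} (one : p 1)
    (smul : ∀ (c : ℂ) ψ, p ψ → p (c • ψ)) (add : ∀ φ ψ, p φ → p ψ → p (φ + ψ))
    (ι_mul : ∀ v ψ, p ψ → p (ι ℂ V v * ψ)) (ψ : Sym V) : p ψ :=
  symOf_induction one smul add (fun v _ => ι_mul v) (mem_symOf_top ψ)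

/-- Every element of `SV` lies in `SM` for a finite-dimensional `M`. -/
theorem exists_fg_mem_symOf (ψ : Sym V) : ∃ M : Submodule ℂ V, M.FG ∧ ψ ∈ symOf M := by
  induction ψ using sym_induction with
  | one => exact ⟨⊥, Submodule.fg_bot, one_mem _⟩
  | smul c ψ h =>
    obtain ⟨M, hM, h⟩ := h
    exact ⟨M, hM, Subalgebra.smul_mem _ h c⟩
  | add φ ψ hφ hψ =>
    obtain ⟨M, hM, hφ⟩ := hφ
    obtain ⟨N, hN, hψ⟩ := hψ
    exact ⟨M ⊔ N, hM.sup hN, add_mem (symOf_mono le_sup_left hφ) (symOf_mono le_sup_right hψ)⟩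
  | ι_mul v ψ h =>
    obtain ⟨M, hM, h⟩ := h
    refine ⟨M ⊔ ℂ ∙ v, hM.sup (Submodule.fg_span_singleton v), mul_mem (ι_mem_symOf ?_)
      (symOf_mono le_sup_left h)⟩
    exact (le_sup_right : ℂ ∙ v ≤ M ⊔ ℂ ∙ v) (Submodule.mem_span_singleton_self v)

theorem exists_orthonormal_span_eq {M : Submodule ℂ V} (hM : M.FG) :
    ∃ (n : ℕ) (e : Fin n → V), Orthonormal ℂ e ∧ Submodule.span ℂ (Set.range e) = M := by
  have : FiniteDimensional ℂ M := Module.Finite.iff_fg.mpr hM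
  let b := stdOrthonormalBasis ℂ M
  refine ⟨_, fun i => (b i : V), b.orthonormal.comp_linearIsometry M.subtypeₗᵢ, ?_⟩
  have h : Set.range (fun i => (b i : V)) = M.subtype '' Set.range b := by
    rw [← Set.range_comp]
    rfl
  rw [h, Submodule.span_image, ← b.coe_toBasis, b.toBasis.span_eq, Submodule.map_top,
    Submodule.range_subtype]

theorem exists_orthonormal_mem_symOf (φ ψ : Sym V) :
    ∃ (n : ℕ) (e : Fin n → V), Orthonormal ℂ e ∧
      φ ∈ symOf (Submodule.span ℂ (Set.range e)) ∧
      ψ ∈ symOf (Submodule.span ℂ (Set.range e)) := by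
  obtain ⟨M, hM, hφ⟩ := exists_fg_mem_symOf φ
  obtain ⟨N, hN, hψ⟩ := exists_fg_mem_symOf ψ
  obtain ⟨n, e, he, hs⟩ := exists_orthonormal_span_eq (hM.sup hN)
  refine ⟨n, e, he, ?_, ?_⟩ <;> rw [hs]
  exacts [symOf_mono le_sup_left hφ, symOf_mono le_sup_right hψ]

theorem sum_inner_smul_of_mem_span {n : ℕ} {e : Fin n → V} (he : Orthonormal ℂ e) {v : V}
    (hv : v ∈ Submodule.span ℂ (Set.range e)) : ∑ i, ⟪e i, v⟫_ℂ • e i = v := by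
  induction hv using Submodule.span_induction with
  | mem x hx =>
    obtain ⟨j, rfl⟩ := hx
    simp [orthonormal_iff_ite.mp he]
  | zero => simp
  | add x y _ _ hx hy => simp only [inner_add_right, add_smul, Finset.sum_add_distrib, hx, hy]
  | smul c x _ hx => simp only [inner_smul_right, mul_smul, ← Finset.smul_sum, hx]

theorem inner_eq_sum_of_mem_span {n : ℕ} {e : Fin n → V} (he : Orthonormal ℂ e) {v : V}
    (hv : v ∈ Submodule.span ℂ (Set.range e)) (x : V) :
    ⟪v, x⟫_ℂ = ∑ i, ⟪v, e i⟫_ℂ * ⟪e i, x⟫_ℂ := by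
  conv_lhs => rw [← sum_inner_smul_of_mem_span he hv]
  simp [mul_comm]

/-! ### Annihilators on `SV` -/

theorem annihilate_ι_mul (v w : V) (ψ : Sym V) :
    annihilate v (ι ℂ V w * ψ) = ⟪v, w⟫_ℂ • ψ + ι ℂ V w * annihilate v ψ := by
  rw [Derivation.leibniz, annihilate_ι, smul_eq_mul, smul_eq_mul, mul_comm ψ, ← Algebra.smul_def,
    add_comm]

theorem annihilate_comm (v w : V) (ψ : Sym V) :
    annihilate v (annihilate w ψ) = annihilate w (annihilate v ψ) := by
  induction ψ using sym_induction with
  | one => simp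
  | smul c ψ h => simp [h]
  | add φ ψ hφ hψ => simp [hφ, hψ]
  | ι_mul u ψ h =>
    simp only [annihilate_ι_mul, map_add, Derivation.map_smul, h]
    abel

theorem annihilate_eq_sum {n : ℕ} {e : Fin n → V} (he : Orthonormal ℂ e) {v : V}
    (hv : v ∈ Submodule.span ℂ (Set.range e)) (ψ : Sym V) :
    annihilate v ψ = ∑ i, ⟪v, e i⟫_ℂ • annihilate (e i) ψ := by
  induction ψ using sym_induction with
  | one => simp
  | smul c ψ h => simp [h, Finset.smul_sum, smul_comm c]
  | add φ ψ hφ hψ => simp [hφ, hψ, Finset.sum_add_distrib]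
  | ι_mul u ψ h =>
    simp only [annihilate_ι_mul, h, smul_add, Finset.sum_add_distrib, smul_smul,
      ← Finset.sum_smul, ← inner_eq_sum_of_mem_span he hv, Finset.mul_sum, mul_smul_comm]

theorem annihilate_incl (v : V) (ψ : Sym V) :
    Antidual.annihilate v (incl ψ) = incl (annihilate v ψ) := by
  induction ψ using sym_induction with
  | one =>
    ext θ
    simp [Antidual.one_def]
  | smul c ψ h => simp [h]
  | add φ ψ hφ hψ => simp [hφ, hψ]
  | ι_mul u ψ h =>
    have hu : incl (ι ℂ V u) = ket u := by simp [incl]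
    rw [map_mul, Antidual.annihilate_mul, h, annihilate_ι_mul, hu, annihilate_ket, map_add,
      map_smul, map_mul, hu, ← Algebra.smul_def]

theorem incl_ι (v : V) : incl (ι ℂ V v) = ket v := by simp [incl]

/-- Both sides satisfy the same commutation relation with every `a(w)` and vanish at `1`. The
induction on `ψ` lets `Φ` vary, since peeling off `w` replaces `Φ` by `a(w)Φ`. -/
theorem Antidual.create_eq_ket_mul (v : V) (Φ : Antidual V) :
    Antidual.create v Φ = ket v * Φ := by
  ext ψ
  induction ψ using sym_induction generalizing Φ with
  | one => simp [Antidual.mul_one_apply, degreeOne_one]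
  | smul c ψ h => rw [map_smulₛₗ, map_smulₛₗ, h]
  | add φ ψ hφ hψ => rw [map_add, map_add, hφ, hψ]
  | ι_mul w ψ h =>
    rw [← Antidual.annihilate_apply w (ket v * Φ), Antidual.annihilate_mul, annihilate_ket,
      ← Algebra.smul_def,
      Antidual.add_apply, ← h, Antidual.create_apply, annihilate_ι_mul, map_add, map_smulₛₗ,
      Antidual.smul_apply, inner_conj_symm, smul_eq_mul, Antidual.create_apply,
      Antidual.annihilate_apply]

/-! ### The inner product of `SV` is positive semidefinite -/

theorem symInner_add_left (φ ψ χ : Sym V) :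
    symInner (φ + ψ) χ = symInner φ χ + symInner ψ χ := map_add _ _ _

theorem symInner_add_right (φ ψ χ : Sym V) :
    symInner φ (ψ + χ) = symInner φ ψ + symInner φ χ := by simp [symInner]

theorem symInner_smul_left (c : ℂ) (φ ψ : Sym V) :
    symInner (c • φ) ψ = conj c * symInner φ ψ := map_smulₛₗ (incl ψ) c φ

theorem symInner_smul_right (c : ℂ) (φ ψ : Sym V) :
    symInner φ (c • ψ) = c * symInner φ ψ := by simp [symInner]

/-- Creators and annihilators are adjoint. -/
theorem symInner_ι_mul_left (v : V) (φ ψ : Sym V) :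
    symInner (ι ℂ V v * φ) ψ = symInner φ (annihilate v ψ) := by
  rw [symInner, symInner, ← annihilate_incl, Antidual.annihilate_apply]

theorem symInner_one_ι_mul (v : V) (ψ : Sym V) : symInner 1 (ι ℂ V v * ψ) = 0 := by
  simp [symInner, incl_ι, Antidual.mul_one_apply, degreeOne_one]

theorem symInner_one_one : symInner (1 : Sym V) 1 = 1 := by
  simp [symInner, Antidual.one_def]

/-- The part of degree `k` of `⟨φ | ψ⟩`, times `k!`, as a sum over an orthonormal family `e`. -/
def gramTerm {n : ℕ} (e : Fin n → V) : ℕ → Sym V → Sym V → ℂ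
  | 0, φ, ψ => conj (symInner 1 φ) * symInner 1 ψ
  | k + 1, φ, ψ => ∑ i, gramTerm e k (annihilate (e i) φ) (annihilate (e i) ψ)

section gramTerm

variable {n : ℕ} {e : Fin n → V}

theorem gramTerm_add_left (k : ℕ) (φ φ' ψ : Sym V) :
    gramTerm e k (φ + φ') ψ = gramTerm e k φ ψ + gramTerm e k φ' ψ := by
  induction k generalizing φ φ' ψ with
  | zero => simp [gramTerm, symInner_add_right, add_mul]
  | succ k ih => simp [gramTerm, ih, Finset.sum_add_distrib]

theorem gramTerm_smul_left (k : ℕ) (c : ℂ) (φ ψ : Sym V) :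
    gramTerm e k (c • φ) ψ = conj c * gramTerm e k φ ψ := by
  induction k generalizing φ ψ with
  | zero => simp [gramTerm, symInner_smul_right, mul_assoc]
  | succ k ih => simp [gramTerm, ih, Finset.mul_sum]

theorem conj_gramTerm (k : ℕ) (φ ψ : Sym V) :
    conj (gramTerm e k φ ψ) = gramTerm e k ψ φ := by
  induction k generalizing φ ψ with
  | zero => simp [gramTerm, mul_comm]
  | succ k ih => simp [gramTerm, ih]

theorem gramTerm_add_right (k : ℕ) (φ ψ ψ' : Sym V) :
    gramTerm e k φ (ψ + ψ') = gramTerm e k φ ψ + gramTerm e k φ ψ' := by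
  rw [← conj_gramTerm, gramTerm_add_left, map_add, conj_gramTerm, conj_gramTerm]

theorem gramTerm_smul_right (k : ℕ) (c : ℂ) (φ ψ : Sym V) :
    gramTerm e k φ (c • ψ) = c * gramTerm e k φ ψ := by
  rw [← conj_gramTerm, gramTerm_smul_left, map_mul, conj_gramTerm, Complex.conj_conj]

theorem gramTerm_sum_right {κ : Type*} (k : ℕ) (φ : Sym V) (s : Finset κ) (ψ : κ → Sym V) :
    gramTerm e k φ (∑ i ∈ s, ψ i) = ∑ i ∈ s, gramTerm e k φ (ψ i) :=
  map_sum (⟨⟨gramTerm e k φ, by simpa using gramTerm_smul_right (e := e) k 0 φ 0⟩,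
    gramTerm_add_right k φ⟩ : Sym V →+ ℂ) ψ s

theorem gramTerm_self_nonneg (k : ℕ) (φ : Sym V) : 0 ≤ (gramTerm e k φ φ).re := by
  induction k generalizing φ with
  | zero =>
    rw [gramTerm, ← Complex.normSq_eq_conj_mul_self, Complex.ofReal_re]
    exact Complex.normSq_nonneg _
  | succ k ih =>
    rw [gramTerm, Complex.re_sum]
    exact Finset.sum_nonneg fun i _ => ih _

theorem gramTerm_one_left (k : ℕ) (ψ : Sym V) : gramTerm e (k + 1) 1 ψ = 0 := by
  refine Finset.sum_eq_zero fun i _ => ?_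
  simpa using gramTerm_smul_left (e := e) k 0 0 (annihilate (e i) ψ)

theorem gramTerm_ι_mul_zero (v : V) (φ ψ : Sym V) : gramTerm e 0 (ι ℂ V v * φ) ψ = 0 := by
  simp [gramTerm, symInner_one_ι_mul]

/-- Adjointness of `v` and `a(v)`, up to the degree. In the induction the contraction `⟨e i, v⟩`
contributes one copy of the right side and the hypothesis for `k` contributes `k + 1` more. -/
theorem gramTerm_ι_mul_succ (he : Orthonormal ℂ e) {v : V}
    (hv : v ∈ Submodule.span ℂ (Set.range e)) (k : ℕ) (φ ψ : Sym V) :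
    gramTerm e (k + 1) (ι ℂ V v * φ) ψ = (k + 1) * gramTerm e k φ (annihilate v ψ) := by
  induction k generalizing φ ψ with
  | zero =>
    rw [annihilate_eq_sum he hv, gramTerm_sum_right, gramTerm]
    simp only [annihilate_ι_mul, gramTerm_add_left, gramTerm_ι_mul_zero, gramTerm_smul_left,
      gramTerm_smul_right, inner_conj_symm]
    simp
  | succ k ih =>
    have h : ∑ i, ⟪v, e i⟫_ℂ * gramTerm e (k + 1) φ (annihilate (e i) ψ) =
        gramTerm e (k + 1) φ (annihilate v ψ) := by
      rw [annihilate_eq_sum he hv, gramTerm_sum_right]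
      simp only [gramTerm_smul_right]
    rw [gramTerm]
    simp only [annihilate_ι_mul, gramTerm_add_left, gramTerm_smul_left, ih, inner_conj_symm,
      Finset.sum_add_distrib, h, annihilate_comm v, ← Finset.mul_sum]
    rw [show ∑ i, gramTerm e k (annihilate (e i) φ) (annihilate (e i) (annihilate v ψ)) =
      gramTerm e (k + 1) φ (annihilate v ψ) from rfl]
    push_cast
    ring

/-- Unfolded, each `gramTerm` is a sum of products `conj ⟨1 | a⋯a φ⟩ ⟨1 | a⋯a ψ⟩`, so hermitian
symmetry and positivity become visible. The bound `N` is uniform in `ψ` because moving `v` across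
the inner product replaces `ψ` by `a(v)ψ`. -/
theorem symInner_eq_sum_gramTerm (he : Orthonormal ℂ e) {φ : Sym V}
    (hφ : φ ∈ symOf (Submodule.span ℂ (Set.range e))) :
    ∃ N : ℕ, ∀ m ≥ N, ∀ ψ, symInner φ ψ =
      ∑ k ∈ Finset.range m, (k.factorial : ℂ)⁻¹ * gramTerm e k φ ψ := by
  refine symOf_induction (p := fun φ => ∃ N : ℕ, ∀ m ≥ N, ∀ ψ, symInner φ ψ =
    ∑ k ∈ Finset.range m, (k.factorial : ℂ)⁻¹ * gramTerm e k φ ψ) ?_ ?_ ?_ ?_ hφ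
  · refine ⟨1, fun m hm ψ => ?_⟩
    obtain ⟨m, rfl⟩ : ∃ l, m = l + 1 := ⟨m - 1, by omega⟩
    simp only [Finset.sum_range_succ', gramTerm_one_left]
    simp [gramTerm, symInner_one_one]
  · rintro c φ ⟨N, hN⟩
    refine ⟨N, fun m hm ψ => ?_⟩
    simp only [symInner_smul_left, hN m hm, gramTerm_smul_left, Finset.mul_sum]
    exact Finset.sum_congr rfl fun k _ => by ring
  · rintro φ φ' ⟨N, hN⟩ ⟨N', hN'⟩
    refine ⟨max N N', fun m hm ψ => ?_⟩
    simp only [symInner_add_left, hN m (le_of_max_le_left hm), hN' m (le_of_max_le_right hm),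
      gramTerm_add_left, mul_add, Finset.sum_add_distrib]
  · rintro v hv φ ⟨N, hN⟩
    -- The factor `v` raises the degree by one: term `k + 1` for `vφ` is term `k` for `φ` against
    -- `a(v)ψ`, and term `0` vanishes.
    refine ⟨N + 1, fun m hm ψ => ?_⟩
    obtain ⟨m, rfl⟩ : ∃ l, m = l + 1 := ⟨m - 1, by omega⟩
    rw [symInner_ι_mul_left, hN m (by omega), Finset.sum_range_succ', gramTerm_ι_mul_zero,
      mul_zero, add_zero]
    refine Finset.sum_congr rfl fun k _ => ?_
    rw [gramTerm_ι_mul_succ he hv, Nat.factorial_succ]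
    have : (k : ℂ) + 1 ≠ 0 := Nat.cast_add_one_ne_zero k
    push_cast
    field_simp

end gramTerm

theorem conj_symInner (φ ψ : Sym V) : conj (symInner ψ φ) = symInner φ ψ := by
  obtain ⟨n, e, he, hφ, hψ⟩ := exists_orthonormal_mem_symOf φ ψ
  obtain ⟨N, hN⟩ := symInner_eq_sum_gramTerm he hφ
  obtain ⟨N', hN'⟩ := symInner_eq_sum_gramTerm he hψ
  rw [hN _ (le_max_left N N'), hN' _ (le_max_right N N'), map_sum]
  simp [conj_gramTerm]

theorem symInner_self_nonneg (ψ : Sym V) : 0 ≤ (symInner ψ ψ).re := by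
  obtain ⟨n, e, he, -, hψ⟩ := exists_orthonormal_mem_symOf ψ ψ
  obtain ⟨N, hN⟩ := symInner_eq_sum_gramTerm he hψ
  rw [hN N le_rfl, Complex.re_sum]
  refine Finset.sum_nonneg fun k _ => ?_
  rw [← Complex.ofReal_natCast, ← Complex.ofReal_inv, Complex.re_ofReal_mul]
  exact mul_nonneg (by positivity) (gramTerm_self_nonneg k ψ)

variable (V) in
/-- The pre-inner product space structure of `SV`. -/
abbrev symCore : PreInnerProductSpace.Core ℂ (Sym V) where
  inner := symInner
  conj_inner_symm := conj_symInner
  re_inner_nonneg := symInner_self_nonneg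
  add_left := symInner_add_left
  smul_left φ ψ c := symInner_smul_left c φ ψ

/-- Cauchy–Schwarz needs only semidefiniteness; definiteness plays no role. -/
theorem norm_symInner_le (φ ψ : Sym V) : ‖symInner φ ψ‖ ≤ symNorm φ * symNorm ψ :=
  @InnerProductSpace.Core.norm_inner_le_norm ℂ (Sym V) _ _ _ (symCore V) φ ψ

theorem symNorm_add_le (φ ψ : Sym V) : symNorm (φ + ψ) ≤ symNorm φ + symNorm ψ :=
  @norm_add_le (Sym V)
    (@InnerProductSpace.Core.toSeminormedAddCommGroup ℂ (Sym V) _ _ _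
      (symCore V)).toSeminormedAddGroup φ ψ

theorem symNorm_nonneg (ψ : Sym V) : 0 ≤ symNorm ψ := Real.sqrt_nonneg _

theorem symNorm_sq (ψ : Sym V) : symNorm ψ ^ 2 = (symInner ψ ψ).re :=
  Real.sq_sqrt (symInner_self_nonneg ψ)

theorem symNorm_smul (c : ℂ) (ψ : Sym V) : symNorm (c • ψ) = ‖c‖ * symNorm ψ := by
  rw [symNorm, symInner_smul_left, symInner_smul_right, ← mul_assoc,
    ← Complex.normSq_eq_conj_mul_self, Complex.re_ofReal_mul, Complex.normSq_eq_norm_sq,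
    Real.sqrt_mul (sq_nonneg _), Real.sqrt_sq (norm_nonneg c), symNorm]

theorem symNorm_zero : symNorm (0 : Sym V) = 0 := by
  simpa using symNorm_smul (0 : ℂ) (0 : Sym V)

theorem symNorm_one : symNorm (1 : Sym V) = 1 := by simp [symNorm, symInner_one_one]

/-- `‖vψ‖² = ‖v‖² ‖ψ‖² + ‖a(v)ψ‖²`, by the canonical commutation relations. -/
theorem symNorm_ι_mul_sq (v : V) (ψ : Sym V) :
    symNorm (ι ℂ V v * ψ) ^ 2 = ‖v‖ ^ 2 * symNorm ψ ^ 2 + symNorm (annihilate v ψ) ^ 2 := by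
  rw [symNorm_sq, symNorm_sq, symNorm_sq, symInner_ι_mul_left, annihilate_ι_mul,
    symInner_add_right, symInner_smul_right, inner_self_eq_norm_sq_to_K,
    ← conj_symInner ψ (ι ℂ V v * annihilate v ψ), symInner_ι_mul_left, conj_symInner,
    Complex.add_re]
  rw [← Complex.re_ofReal_mul]
  norm_cast

theorem symInner_ι_mul_right (v : V) (φ ψ : Sym V) :
    symInner φ (ι ℂ V v * ψ) = symInner (annihilate v φ) ψ := by
  rw [← conj_symInner, symInner_ι_mul_left, conj_symInner]

theorem symInner_sum_right {κ : Type*} (φ : Sym V) (s : Finset κ) (ψ : κ → Sym V) :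
    symInner φ (∑ i ∈ s, ψ i) = ∑ i ∈ s, symInner φ (ψ i) :=
  map_sum (⟨⟨symInner φ, by simp [symInner]⟩, symInner_add_right φ⟩ : Sym V →+ ℂ) ψ s

theorem symInner_self (ψ : Sym V) : symInner ψ ψ = ((symNorm ψ ^ 2 : ℝ) : ℂ) := by
  rw [symNorm_sq]
  exact (Complex.conj_eq_iff_re.mp (conj_symInner ψ ψ)).symm

/-! ### Degree bounds -/

/-- `ψ` has degree at most `m`: any `m + 1` annihilators kill it. -/
def DegLE : ℕ → Sym V → Prop
  | 0, ψ => ∀ v, annihilate v ψ = 0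
  | m + 1, ψ => ∀ v, DegLE m (annihilate v ψ)

namespace DegLE

theorem zero (m : ℕ) : DegLE m (0 : Sym V) := by
  induction m with
  | zero => exact fun v => map_zero _
  | succ m ih =>
    intro v
    rwa [map_zero]

theorem one (m : ℕ) : DegLE m (1 : Sym V) := by
  cases m with
  | zero => exact fun v => Derivation.map_one_eq_zero _
  | succ m =>
    intro v
    rw [Derivation.map_one_eq_zero]
    exact zero m

theorem add {m : ℕ} {φ ψ : Sym V} (hφ : DegLE m φ) (hψ : DegLE m ψ) : DegLE m (φ + ψ) := by
  induction m generalizing φ ψ with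
  | zero =>
    intro v
    rw [map_add, hφ v, hψ v, add_zero]
  | succ m ih =>
    intro v
    rw [map_add]
    exact ih (hφ v) (hψ v)

theorem smul {m : ℕ} {ψ : Sym V} (hψ : DegLE m ψ) (c : ℂ) : DegLE m (c • ψ) := by
  induction m generalizing ψ with
  | zero =>
    intro v
    rw [Derivation.map_smul, hψ v, smul_zero]
  | succ m ih =>
    intro v
    rw [Derivation.map_smul]
    exact ih (hψ v)

theorem sum {m : ℕ} {κ : Type*} {s : Finset κ} {ψ : κ → Sym V} (h : ∀ i ∈ s, DegLE m (ψ i)) :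
    DegLE m (∑ i ∈ s, ψ i) :=
  Finset.sum_induction ψ (DegLE m) (fun _ _ => add) (zero m) h

theorem succ {m : ℕ} {ψ : Sym V} (h : DegLE m ψ) : DegLE (m + 1) ψ := by
  induction m generalizing ψ with
  | zero =>
    intro v
    rw [h v]
    exact zero 0
  | succ m ih => exact fun v => ih (h v)

theorem mono {m m' : ℕ} (hm : m ≤ m') {ψ : Sym V} (h : DegLE m ψ) : DegLE m' ψ := by
  induction m', hm using Nat.le_induction with
  | base => exact h
  | succ k _ ih => exact ih.succ

theorem ι_mul {m : ℕ} {ψ : Sym V} (h : DegLE m ψ) (v : V) : DegLE (m + 1) (ι ℂ V v * ψ) := by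
  induction m generalizing ψ with
  | zero =>
    intro w
    rw [annihilate_ι_mul, h w, mul_zero, add_zero]
    exact h.smul _
  | succ m ih =>
    intro w
    rw [annihilate_ι_mul]
    exact (h.smul _).add (ih (h w))

end DegLE

/-! ### Norm of multiplication operators in bounded degree. -/

theorem symNorm_annihilate_sq_le (v : V) (ψ : Sym V) :
    symNorm (annihilate v ψ) ^ 2 ≤ symNorm ψ * symNorm (ι ℂ V v * annihilate v ψ) := by
  rw [symNorm_sq (annihilate v ψ), ← symInner_ι_mul_right]
  exact (Complex.re_le_norm _).trans (norm_symInner_le _ _)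

/-- By the commutation relations it suffices to bound `‖a(v)ψ‖²`. This is at most `‖ψ‖ ‖v a(v)ψ‖`,
and since `a(v)ψ` has lower degree, the induction hypothesis bounds `‖v a(v)ψ‖` by a multiple of
`‖a(v)ψ‖`, which cancels. -/
theorem symNorm_ι_mul_sq_le (v : V) {m : ℕ} {ψ : Sym V} (h : DegLE m ψ) :
    symNorm (ι ℂ V v * ψ) ^ 2 ≤ (m + 1) * ‖v‖ ^ 2 * symNorm ψ ^ 2 := by
  induction m generalizing ψ with
  | zero => simp [symNorm_ι_mul_sq, h v, symNorm_zero]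
  | succ m ih =>
    rw [symNorm_ι_mul_sq]
    have h1 := symNorm_annihilate_sq_le v ψ
    have h2 := ih (h v)
    set x := symNorm (annihilate v ψ) with hx
    set y := symNorm (ι ℂ V v * annihilate v ψ)
    set c := symNorm ψ
    have hx0 : 0 ≤ x := symNorm_nonneg _
    have hc0 : 0 ≤ c := symNorm_nonneg _
    have hy0 : 0 ≤ y := symNorm_nonneg _
    have h3 : x ^ 2 ≤ (m + 1) * ‖v‖ ^ 2 * c ^ 2 := by
      -- Cancelling `x ^ 2` requires `x ≠ 0`.
      rcases hx0.eq_or_lt with h0 | h0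
      · rw [← h0, zero_pow two_ne_zero]
        positivity
      · have h4 : x ^ 2 * x ^ 2 ≤ (m + 1) * ‖v‖ ^ 2 * c ^ 2 * x ^ 2 := by
          calc x ^ 2 * x ^ 2 ≤ (c * y) * (c * y) := by gcongr
            _ = c ^ 2 * y ^ 2 := by ring
            _ ≤ c ^ 2 * ((m + 1) * ‖v‖ ^ 2 * x ^ 2) := by gcongr
            _ = _ := by ring
        exact le_of_mul_le_mul_right h4 (by positivity)
    push_cast
    linarith

theorem symNorm_ι_mul_le (v : V) {m : ℕ} {ψ : Sym V} (h : DegLE m ψ) :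
    symNorm (ι ℂ V v * ψ) ≤ (m + 1) * ‖v‖ * symNorm ψ := by
  have h0 := symNorm_nonneg ψ
  refine le_of_sq_le_sq ?_ (by positivity)
  refine (symNorm_ι_mul_sq_le v h).trans ?_
  have h1 : (m : ℝ) + 1 ≤ (m + 1) ^ 2 := by nlinarith [(Nat.cast_nonneg m : (0 : ℝ) ≤ m)]
  calc (m + 1) * ‖v‖ ^ 2 * symNorm ψ ^ 2 ≤ (m + 1) ^ 2 * ‖v‖ ^ 2 * symNorm ψ ^ 2 := by gcongr
    _ = _ := by ring

/-- Multiplication by a fixed `φ ∈ SV` has norm growing polynomially with the degree. -/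
theorem exists_symNorm_mul_le (φ : Sym V) : ∃ (K : ℝ) (d : ℕ), 0 ≤ K ∧
    ∀ (m : ℕ) (ψ : Sym V), DegLE m ψ →
      DegLE (m + d) (φ * ψ) ∧ symNorm (φ * ψ) ≤ K * (m + 1) ^ d * symNorm ψ := by
  induction φ using sym_induction with
  | one => exact ⟨1, 0, zero_le_one, fun m ψ h => by simpa using h⟩
  | smul c φ h =>
    obtain ⟨K, d, hK, h⟩ := h
    refine ⟨‖c‖ * K, d, by positivity, fun m ψ hψ => ?_⟩
    rw [smul_mul_assoc, symNorm_smul, mul_assoc, mul_assoc, ← mul_assoc K]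
    exact ⟨(h m ψ hψ).1.smul c, mul_le_mul_of_nonneg_left (h m ψ hψ).2 (norm_nonneg c)⟩
  | add φ φ' h h' =>
    obtain ⟨K, d, hK, h⟩ := h
    obtain ⟨K', d', hK', h'⟩ := h'
    refine ⟨K + K', max d d', by positivity, fun m ψ hψ => ?_⟩
    obtain ⟨h1, h2⟩ := h m ψ hψ
    obtain ⟨h1', h2'⟩ := h' m ψ hψ
    have h0 := symNorm_nonneg ψ
    have hm : (1 : ℝ) ≤ m + 1 := by simp
    rw [add_mul]
    refine ⟨(h1.mono (by omega)).add (h1'.mono (by omega)), (symNorm_add_le _ _).trans ?_⟩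
    rw [add_mul, add_mul]
    refine add_le_add (h2.trans ?_) (h2'.trans ?_)
    · gcongr
      exact le_max_left _ _
    · gcongr
      exact le_max_right _ _
  | ι_mul v φ h =>
    obtain ⟨K, d, hK, h⟩ := h
    refine ⟨(d + 1) * ‖v‖ * K, d + 1, by positivity, fun m ψ hψ => ?_⟩
    obtain ⟨h1, h2⟩ := h m ψ hψ
    have h0 := symNorm_nonneg ψ
    have h0' := symNorm_nonneg (φ * ψ)
    rw [mul_assoc]
    refine ⟨h1.ι_mul v, (symNorm_ι_mul_le v h1).trans ?_⟩
    have h3 : ((m + d : ℕ) : ℝ) + 1 ≤ (d + 1) * (m + 1) := by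
      push_cast
      nlinarith [(by positivity : (0 : ℝ) ≤ d * m)]
    calc ((m + d : ℕ) + 1) * ‖v‖ * symNorm (φ * ψ)
        ≤ ((d + 1) * (m + 1)) * ‖v‖ * (K * (m + 1) ^ d * symNorm ψ) := by gcongr
      _ = _ := by ring

/-! ### Gaussians compressed to a finite-dimensional subspace -/

/-- The compression `PZ` of `Z`, with `P` the orthogonal projection onto the span of the
orthonormal family `e`. -/
def compress {n : ℕ} (e : Fin n → V) (Z : V →SL[starRingEnd ℂ] V) (v : V) : V :=
  ∑ j, ⟪e j, Z v⟫_ℂ • e j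

/-- The element of `S²V` that corresponds to `PZP`. -/
def compressedQuadratic {n : ℕ} (e : Fin n → V) (Z : V →SL[starRingEnd ℂ] V) : Sym V :=
  (2⁻¹ : ℂ) • ∑ i, ι ℂ V (e i) * ι ℂ V (compress e Z (e i))

/-- The part of degree `2k` of the exponential of `compressedQuadratic e Z`. -/
def gaussTerm {n : ℕ} (e : Fin n → V) (Z : V →SL[starRingEnd ℂ] V) (k : ℕ) : Sym V :=
  (k.factorial : ℂ)⁻¹ • compressedQuadratic e Z ^ k

/-- `majorant r T k` bounds `‖ζᵏ / k!‖²` when `‖Z‖² ≤ r` and `Z` has squared Hilbert–Schmidt norm at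
most `T`. -/
def majorant (r T : ℝ) : ℕ → ℝ
  | 0 => 1
  | k + 1 => (r + T / (2 * (k + 1))) * majorant r T k

theorem majorant_nonneg {r T : ℝ} (hr : 0 ≤ r) (hT : 0 ≤ T) (k : ℕ) : 0 ≤ majorant r T k := by
  induction k with
  | zero => exact zero_le_one
  | succ k ih =>
    rw [majorant]
    positivity

section compress

variable {n : ℕ} {e : Fin n → V} {Z : V →SL[starRingEnd ℂ] V}

theorem compress_mem_span (v : V) : compress e Z v ∈ Submodule.span ℂ (Set.range e) :=
  Submodule.sum_mem _ fun j _ => Submodule.smul_mem _ _ (Submodule.subset_span ⟨j, rfl⟩)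

theorem norm_compress_sq_le (he : Orthonormal ℂ e) (v : V) : ‖compress e Z v‖ ^ 2 ≤ ‖Z v‖ ^ 2 := by
  have h : ‖compress e Z v‖ ^ 2 = ∑ j, ‖⟪e j, Z v⟫_ℂ‖ ^ 2 := by
    rw [← inner_self_eq_norm_sq (𝕜 := ℂ), compress, he.inner_sum, map_sum]
    refine Finset.sum_congr rfl fun j _ => ?_
    rw [← Complex.normSq_eq_conj_mul_self, RCLike.re_to_complex, Complex.ofReal_re,
      Complex.normSq_eq_norm_sq]
  rw [h]
  exact he.sum_inner_products_le (Z v)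

/-- Differentiating either factor of `eᵢ · PZeᵢ` and summing over `i` gives `PZv`, one of the two by
the symmetry of `Z`; the factor `1/2` in the quadratic absorbs the doubling. -/
theorem annihilate_compressedQuadratic (he : Orthonormal ℂ e) (hZ : IsSymmetricAnti Z) {v : V}
    (hv : v ∈ Submodule.span ℂ (Set.range e)) :
    annihilate v (compressedQuadratic e Z) = ι ℂ V (compress e Z v) := by
  have h1 : ∑ i, ⟪v, e i⟫_ℂ • compress e Z (e i) = compress e Z v := by
    simp only [compress, Finset.smul_sum, smul_smul]
    rw [Finset.sum_comm]
    refine Finset.sum_congr rfl fun j _ => ?_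
    rw [← Finset.sum_smul, hZ v (e j), inner_eq_sum_of_mem_span he hv]
    congr 1
    exact Finset.sum_congr rfl fun i _ => by rw [hZ (e i) (e j)]
  have h2 : ∀ i, ⟪v, compress e Z (e i)⟫_ℂ = ⟪e i, Z v⟫_ℂ := by
    intro i
    rw [hZ v (e i), inner_eq_sum_of_mem_span he hv (Z (e i))]
    simp only [compress, inner_sum, inner_smul_right]
    exact Finset.sum_congr rfl fun j _ => mul_comm _ _
  have h3 : ∑ i, annihilate v (ι ℂ V (e i) * ι ℂ V (compress e Z (e i))) =
      ι ℂ V (∑ i, ⟪v, e i⟫_ℂ • compress e Z (e i)) + ι ℂ V (compress e Z v) := by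
    simp only [annihilate_ι_mul, annihilate_ι, h2, Finset.sum_add_distrib, map_sum, map_smul]
    congr 1
    simp only [compress, map_sum, map_smul, Algebra.smul_def]
    exact Finset.sum_congr rfl fun i _ => mul_comm _ _
  rw [compressedQuadratic, Derivation.map_smul, map_sum, h3, h1, ← two_smul ℂ, smul_smul]
  simp

theorem annihilate_gaussTerm_succ (he : Orthonormal ℂ e) (hZ : IsSymmetricAnti Z) {v : V}
    (hv : v ∈ Submodule.span ℂ (Set.range e)) (k : ℕ) :
    annihilate v (gaussTerm e Z (k + 1)) = ι ℂ V (compress e Z v) * gaussTerm e Z k := by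
  rw [gaussTerm, Derivation.map_smul, Derivation.leibniz_pow,
    annihilate_compressedQuadratic he hZ hv, Nat.add_sub_cancel, gaussTerm, mul_smul_comm,
    smul_eq_mul, mul_comm, ← Nat.cast_smul_eq_nsmul ℂ, smul_smul, Nat.factorial_succ]
  congr 1
  have : (k : ℂ) + 1 ≠ 0 := Nat.cast_add_one_ne_zero k
  push_cast
  field_simp

/-- Euler's identity for the homogeneous polynomial `gaussTerm e Z (k + 1)`. -/
theorem sum_ι_mul_ι_mul_gaussTerm (k : ℕ) :
    ∑ i, ι ℂ V (e i) * (ι ℂ V (compress e Z (e i)) * gaussTerm e Z k) =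
      (2 * (k + 1) : ℂ) • gaussTerm e Z (k + 1) := by
  simp only [← mul_assoc, ← Finset.sum_mul]
  have h : ∑ i, ι ℂ V (e i) * ι ℂ V (compress e Z (e i)) =
      (2 : ℂ) • compressedQuadratic e Z := by
    rw [compressedQuadratic, smul_smul]
    simp
  rw [h, gaussTerm, gaussTerm, smul_mul_smul_comm, ← pow_succ', smul_smul, Nat.factorial_succ]
  congr 1
  have : (k : ℂ) + 1 ≠ 0 := Nat.cast_add_one_ne_zero k
  push_cast
  field_simp

/-- Pair Euler's identity with `gaussTerm e Z (k + 1)` and move each `e i` across: `a(e i)` turns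
that factor into the very vector it is paired with. -/
theorem symNorm_gaussTerm_succ_sq (he : Orthonormal ℂ e) (hZ : IsSymmetricAnti Z) (k : ℕ) :
    2 * (k + 1) * symNorm (gaussTerm e Z (k + 1)) ^ 2 =
      ∑ i, symNorm (ι ℂ V (compress e Z (e i)) * gaussTerm e Z k) ^ 2 := by
  have h : (2 * (k + 1) : ℂ) * symInner (gaussTerm e Z (k + 1)) (gaussTerm e Z (k + 1)) =
      ∑ i, symInner (ι ℂ V (compress e Z (e i)) * gaussTerm e Z k)
        (ι ℂ V (compress e Z (e i)) * gaussTerm e Z k) := by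
    rw [← symInner_smul_right, ← sum_ι_mul_ι_mul_gaussTerm, symInner_sum_right]
    refine Finset.sum_congr rfl fun i _ => ?_
    rw [symInner_ι_mul_right, annihilate_gaussTerm_succ he hZ (Submodule.subset_span ⟨i, rfl⟩)]
  simp only [symInner_self] at h
  exact_mod_cast h

theorem degLE_gaussTerm (k : ℕ) : DegLE (2 * k) (gaussTerm e Z k) := by
  refine DegLE.smul ?_ _
  induction k with
  | zero =>
    rw [pow_zero]
    exact DegLE.one _
  | succ k ih =>
    rw [pow_succ']
    nth_rw 1 [compressedQuadratic]
    rw [smul_mul_assoc, Finset.sum_mul]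
    refine DegLE.smul (DegLE.sum fun i _ => ?_) _
    rw [mul_assoc]
    exact (ih.ι_mul _).ι_mul _

/-- The two bounds feed each other: the first at `k + 1` uses the second with `u = PZeᵢ`, and the
second at `k + 1` uses the first there and the second at `PZu`. The general degree bound for `‖u
gₖ‖` would only give `‖gₖ₊₁‖² ≤ T ‖gₖ‖²`, useless for `T ≥ 1`; carrying the second bound makes the
operator norm decide the growth. -/
theorem symNorm_gaussTerm_sq_le (he : Orthonormal ℂ e) (hZ : IsSymmetricAnti Z) {r T : ℝ}
    (hr0 : 0 ≤ r) (hT0 : 0 ≤ T) (hr : ∀ v, ‖compress e Z v‖ ^ 2 ≤ r * ‖v‖ ^ 2)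
    (hT : ∑ i, ‖compress e Z (e i)‖ ^ 2 ≤ T) (k : ℕ) :
    symNorm (gaussTerm e Z k) ^ 2 ≤ majorant r T k ∧
      ∀ u ∈ Submodule.span ℂ (Set.range e),
        symNorm (ι ℂ V u * gaussTerm e Z k) ^ 2 ≤ ‖u‖ ^ 2 * majorant r T k := by
  induction k with
  | zero =>
    have h : gaussTerm e Z 0 = 1 := by simp [gaussTerm]
    rw [h, majorant, symNorm_one]
    refine ⟨by simp, fun u _ => ?_⟩
    rw [symNorm_ι_mul_sq, Derivation.map_one_eq_zero, symNorm_zero, symNorm_one]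
    simp
  | succ k ih =>
    have hm := majorant_nonneg hr0 hT0 k
    have h1 : symNorm (gaussTerm e Z (k + 1)) ^ 2 ≤ T / (2 * (k + 1)) * majorant r T k := by
      have h2 : 2 * (k + 1) * symNorm (gaussTerm e Z (k + 1)) ^ 2 ≤ T * majorant r T k := by
        rw [symNorm_gaussTerm_succ_sq he hZ]
        refine (Finset.sum_le_sum fun i _ => ih.2 _ (compress_mem_span _)).trans ?_
        rw [← Finset.sum_mul]
        gcongr
      rw [div_mul_eq_mul_div, le_div_iff₀ (by positivity)]
      linarith
    refine ⟨?_, fun u hu => ?_⟩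
    · rw [majorant, add_mul]
      have : 0 ≤ r * majorant r T k := by positivity
      linarith
    · rw [symNorm_ι_mul_sq, annihilate_gaussTerm_succ he hZ hu, majorant]
      have h3 := (ih.2 _ (compress_mem_span (e := e) (Z := Z) u)).trans
        (mul_le_mul_of_nonneg_right (hr u) hm)
      have h4 := mul_le_mul_of_nonneg_left h1 (sq_nonneg ‖u‖)
      linarith

end compress

/-! ### Agreement of functionals on the symmetric algebra of a subspace -/

namespace Antidual

/-- The functionals `Φ` and `Ψ` have the same restriction to `SM`. -/
def AgreeOn (M : Submodule ℂ V) (Φ Ψ : Antidual V) : Prop := ∀ ψ ∈ symOf M, Φ ψ = Ψ ψ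

theorem AgreeOn.annihilate {M : Submodule ℂ V} {Φ Ψ : Antidual V} (h : AgreeOn M Φ Ψ) {v : V}
    (hv : v ∈ M) : AgreeOn M (annihilate v Φ) (annihilate v Ψ) :=
  fun _ hψ => h _ (mul_mem (ι_mem_symOf hv) hψ)

theorem agreeOn_of_annihilate {M : Submodule ℂ V} {Φ Ψ : Antidual V} (h1 : Φ 1 = Ψ 1)
    (h : ∀ v ∈ M, AgreeOn M (annihilate v Φ) (annihilate v Ψ)) : AgreeOn M Φ Ψ := by
  intro ψ hψ
  refine (symOf_induction (p := fun ψ => ψ ∈ symOf M ∧ Φ ψ = Ψ ψ) ⟨one_mem _, h1⟩ ?_ ?_ ?_ hψ).2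
  · rintro c ψ ⟨hψ, hc⟩
    exact ⟨Subalgebra.smul_mem _ hψ c, by rw [map_smulₛₗ, map_smulₛₗ, hc]⟩
  · rintro φ ψ ⟨hφ, hc⟩ ⟨hψ, hd⟩
    exact ⟨add_mem hφ hψ, by rw [map_add, map_add, hc, hd]⟩
  · rintro v hv ψ ⟨hψ, -⟩
    exact ⟨mul_mem (ι_mem_symOf hv) hψ, h v hv ψ hψ⟩

/-- The derivation rule for `a(v)`, `v ∈ M`, replaces a study of the coproduct on `SM`. All four
functionals vary in the induction, since `a(v)` alters them. -/
theorem AgreeOn.mul {M : Submodule ℂ V} {Φ Φ' Ψ Ψ' : Antidual V} (h : AgreeOn M Φ Φ')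
    (h' : AgreeOn M Ψ Ψ') : AgreeOn M (Φ * Ψ) (Φ' * Ψ') := by
  intro ψ hψ
  refine symOf_induction (p := fun ψ => ∀ Φ Φ' Ψ Ψ' : Antidual V, AgreeOn M Φ Φ' →
    AgreeOn M Ψ Ψ' → (Φ * Ψ) ψ = (Φ' * Ψ') ψ) ?_ ?_ ?_ ?_ hψ Φ Φ' Ψ Ψ' h h'
  · intro Φ Φ' Ψ Ψ' h h'
    rw [mul_one_apply, mul_one_apply, h 1 (one_mem _), h' 1 (one_mem _)]
  · intro c ψ ih Φ Φ' Ψ Ψ' h h'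
    rw [map_smulₛₗ, map_smulₛₗ, ih Φ Φ' Ψ Ψ' h h']
  · intro φ ψ ih ih' Φ Φ' Ψ Ψ' h h'
    rw [map_add, map_add, ih Φ Φ' Ψ Ψ' h h', ih' Φ Φ' Ψ Ψ' h h']
  · intro v hv ψ ih Φ Φ' Ψ Ψ' h h'
    rw [← annihilate_apply, ← annihilate_apply, annihilate_mul, annihilate_mul, add_apply,
      add_apply, ih _ _ _ _ (h.annihilate hv) h', ih _ _ _ _ h (h'.annihilate hv)]

theorem AgreeOn.pow {M : Submodule ℂ V} {Φ Ψ : Antidual V} (h : AgreeOn M Φ Ψ) (k : ℕ) :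
    AgreeOn M (Φ ^ k) (Ψ ^ k) := by
  induction k with
  | zero => exact fun ψ _ => by simp
  | succ k ih =>
    rw [pow_succ, pow_succ]
    exact ih.mul h

/-! ### Products with exponentials -/

/-- The coproduct of `ψ` is a finite sum of pure tensors, so multiplication by `Φ` passes through
the series. -/
theorem hasSum_mul_exp (Φ ζ : Antidual V) (h : ζ 1 = 0) (ψ : Sym V) :
    HasSum (fun k : ℕ => (k.factorial : ℂ)⁻¹ * (Φ * ζ ^ k) ψ) ((Φ * exp ζ h) ψ) := by
  obtain ⟨S, hS⟩ := TensorProduct.exists_finset (Coalgebra.comul (R := ℂ) ψ)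
  rw [mul_apply_of_comul_eq S Prod.fst Prod.snd ψ hS]
  have hf : ∀ k : ℕ, (k.factorial : ℂ)⁻¹ * (Φ * ζ ^ k) ψ =
      ∑ i ∈ S, Φ i.1 * ((k.factorial : ℂ)⁻¹ * (ζ ^ k) i.2) := by
    intro k
    rw [mul_apply_of_comul_eq S Prod.fst Prod.snd ψ hS, Finset.mul_sum]
    exact Finset.sum_congr rfl fun i _ => by ring
  rw [funext hf]
  exact hasSum_sum fun i _ => (hasSum_exp ζ h i.2).mul_left (Φ i.1)

theorem annihilate_exp (v : V) (ζ : Antidual V) (h : ζ 1 = 0) :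
    annihilate v (exp ζ h) = annihilate v ζ * exp ζ h := by
  ext ψ
  refine HasSum.unique ?_ (hasSum_mul_exp (annihilate v ζ) ζ h ψ)
  -- The term `ζ⁰ = 1` is killed by `a(v)`; term `k + 1` on the left then matches term `k` on the
  -- right.
  have h1 := (hasSum_nat_add_iff' 1).mpr (hasSum_exp ζ h (ι ℂ V v * ψ))
  have h0 : (ζ ^ 0) (ι ℂ V v * ψ) = 0 := by
    rw [← annihilate_apply, pow_zero, ← map_one incl, annihilate_incl]
    simp
  rw [Finset.sum_range_one, h0, mul_zero, sub_zero] at h1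
  have hf : ∀ k : ℕ, (k.factorial : ℂ)⁻¹ * (annihilate v ζ * ζ ^ k) ψ =
      ((k + 1).factorial : ℂ)⁻¹ * (ζ ^ (k + 1)) (ι ℂ V v * ψ) := by
    intro k
    rw [← annihilate_apply, annihilate_pow_succ, smul_apply, mul_comm (ζ ^ k), Nat.factorial_succ]
    have : (k : ℂ) + 1 ≠ 0 := Nat.cast_add_one_ne_zero k
    push_cast
    field_simp
  rw [annihilate_apply, funext hf]
  exact h1

end Antidual

/-! ### Annihilators on the Gaussian, and restriction to finite dimensions. -/

theorem annihilate_quadratic {Z : V →SL[starRingEnd ℂ] V} (hZ : IsSymmetricAnti Z) (v : V) :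
    Antidual.annihilate v (quadratic Z) = ket (Z v) := by
  ext ψ
  rw [Antidual.annihilate_apply, quadratic_ι_mul hZ, ket_apply]

theorem annihilate_gaussian {Z : V →SL[starRingEnd ℂ] V} (hZ : IsSymmetricAnti Z) (v : V) :
    Antidual.annihilate v (gaussian Z) = ket (Z v) * gaussian Z := by
  rw [gaussian, Antidual.annihilate_exp, annihilate_quadratic hZ]

/-- Two annihilators from `M` reduce both sides to constants, `⟨w, Zv⟩` and `⟨w, PZv⟩`, which
coincide for `w ∈ M`. -/
theorem agreeOn_quadratic {n : ℕ} {e : Fin n → V} (he : Orthonormal ℂ e)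
    {Z : V →SL[starRingEnd ℂ] V} (hZ : IsSymmetricAnti Z) :
    Antidual.AgreeOn (Submodule.span ℂ (Set.range e)) (quadratic Z)
      (incl (compressedQuadratic e Z)) := by
  refine Antidual.agreeOn_of_annihilate ?_ fun v hv => ?_
  · rw [quadratic_one, incl_apply, compressedQuadratic, symInner_smul_right, symInner_sum_right]
    simp [symInner_one_ι_mul]
  rw [annihilate_quadratic hZ, annihilate_incl, annihilate_compressedQuadratic he hZ hv, incl_ι]
  refine Antidual.agreeOn_of_annihilate (by simp [degreeOne_one]) fun w hw => ?_
  have h : ⟪w, compress e Z v⟫_ℂ = ⟪w, Z v⟫_ℂ := by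
    rw [inner_eq_sum_of_mem_span he hw (Z v)]
    simp only [compress, inner_sum, inner_smul_right]
    exact Finset.sum_congr rfl fun j _ => mul_comm _ _
  rw [annihilate_ket, annihilate_ket, h]
  exact fun _ _ => rfl

/-! ### Bounds -/

theorem mem_fockSpace_of_norm_le {Φ : Antidual V} {K : ℝ} (hK : 0 ≤ K)
    (h : ∀ ψ, ‖Φ ψ‖ ≤ K * symNorm ψ) : Φ ∈ fockSpace V := by
  refine lt_of_le_of_lt (iSup₂_le fun ψ hψ => ?_) (ENNReal.ofReal_lt_top (r := K))
  rw [← ofReal_norm]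
  exact ENNReal.ofReal_le_ofReal ((h ψ).trans (mul_le_of_le_one_right hK hψ))

/-- Expand `‖Z eᵢ‖²` in the Hilbert basis `b` by Parseval, swap `eᵢ` and `bⱼ` by the symmetry of
`Z`, and apply Bessel's inequality to `Z bⱼ`. -/
theorem IsHilbertSchmidt.exists_sum_norm_sq_le {Z : V →SL[starRingEnd ℂ] V}
    (hHS : IsHilbertSchmidt Z) (hZ : IsSymmetricAnti Z) :
    ∃ T : ℝ, 0 ≤ T ∧ ∀ (n : ℕ) (e : Fin n → V), Orthonormal ℂ e → ∑ i, ‖Z (e i)‖ ^ 2 ≤ T := by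
  obtain ⟨s, b, hb⟩ := hHS
  refine ⟨∑' j, ‖Z (b j)‖ ^ 2, tsum_nonneg fun j => sq_nonneg _, fun n e he => ?_⟩
  have h1 : ∀ x : V, HasSum (fun j => ‖⟪b j, x⟫_ℂ‖ ^ 2) (‖x‖ ^ 2) := by
    intro x
    have h := Complex.hasSum_re (b.hasSum_inner_mul_inner x x)
    rw [← RCLike.re_to_complex, inner_self_eq_norm_sq] at h
    have hf : ∀ j, ‖⟪b j, x⟫_ℂ‖ ^ 2 = (⟪x, b j⟫_ℂ * ⟪b j, x⟫_ℂ).re := by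
      intro j
      rw [← inner_conj_symm x, ← Complex.normSq_eq_conj_mul_self, Complex.ofReal_re,
        Complex.normSq_eq_norm_sq]
    rw [funext hf]
    exact h
  refine hasSum_le (fun j => ?_) (hasSum_sum fun i (_ : i ∈ Finset.univ) => h1 (Z (e i))) hb.hasSum
  refine le_trans (le_of_eq (Finset.sum_congr rfl fun i _ => ?_)) (he.sum_inner_products_le (Z (b j)))
  rw [hZ]

/-- Ratio test: the polynomial factor has ratio tending to `1`, the other factor has ratio tending
to `√r`. -/
theorem summable_mul_sqrt_majorant {r T : ℝ} (hr : 0 < r) (hr1 : r < 1) (hT : 0 ≤ T) (d : ℕ) :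
    Summable fun k : ℕ => (2 * (k : ℝ) + 1) ^ d * √(majorant r T k) := by
  have hpos : ∀ k, 0 < majorant r T k := by
    intro k
    induction k with
    | zero => exact zero_lt_one
    | succ k ih =>
      rw [majorant]
      positivity
  have hpos' : ∀ k : ℕ, 0 < (2 * (k : ℝ) + 1) ^ d * √(majorant r T k) := fun k =>
    mul_pos (by positivity) (Real.sqrt_pos.mpr (hpos k))
  refine summable_of_ratio_test_tendsto_lt_one (l := √r) ?_
    (Filter.Eventually.of_forall fun k => (hpos' k).ne') ?_
  · rw [Real.sqrt_lt' one_pos]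
    simpa using hr1
  have hinv : Filter.Tendsto (fun k : ℕ => ((k : ℝ))⁻¹) Filter.atTop (nhds 0) :=
    tendsto_inv_atTop_nhds_zero_nat
  have h1 : Filter.Tendsto (fun k : ℕ => 1 + 2 / (2 * (k : ℝ) + 1)) Filter.atTop (nhds 1) := by
    have : Filter.Tendsto (fun k : ℕ => 2 * (k : ℝ) + 1) Filter.atTop Filter.atTop :=
      Filter.tendsto_atTop_add_const_right _ _
        (tendsto_natCast_atTop_atTop.const_mul_atTop two_pos)
    simpa using (this.const_div_atTop 2).const_add 1
  have h2 : Filter.Tendsto (fun k : ℕ => r + T / (2 * ((k : ℝ) + 1))) Filter.atTop (nhds r) := by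
    have : Filter.Tendsto (fun k : ℕ => 2 * ((k : ℝ) + 1)) Filter.atTop Filter.atTop :=
      (Filter.tendsto_atTop_add_const_right _ _ tendsto_natCast_atTop_atTop).const_mul_atTop two_pos
    simpa using (this.const_div_atTop T).const_add r
  have h3 := (h1.pow d).mul ((Real.continuous_sqrt.tendsto r).comp h2)
  rw [one_pow, one_mul] at h3
  refine h3.congr fun k => ?_
  rw [Real.norm_of_nonneg (hpos' _).le, Real.norm_of_nonneg (hpos' _).le, majorant,
    Real.sqrt_mul (by positivity), Function.comp_apply]
  have h4 := Real.sqrt_pos.mpr (hpos k)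
  have h5 : (2 * (k : ℝ) + 1) ≠ 0 := by positivity
  have h6 : 1 + 2 / (2 * (k : ℝ) + 1) = (2 * ((k + 1 : ℕ) : ℝ) + 1) / (2 * k + 1) := by
    push_cast
    field_simp
    ring
  rw [h6, div_pow]
  field_simp

/-! ### Boundedness of `φ e^Z`. -/

theorem incl_mul_gaussian_mem_fockSpace {Z : V →SL[starRingEnd ℂ] V} (hHS : IsHilbertSchmidt Z)
    (hZ : IsSymmetricAnti Z) (hnorm : ‖Z‖ < 1) (φ : Sym V) :
    incl φ * gaussian Z ∈ fockSpace V := by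
  obtain ⟨T, hT0, hT⟩ := hHS.exists_sum_norm_sq_le hZ
  obtain ⟨K, d, hK, hφ⟩ := exists_symNorm_mul_le φ
  -- The midpoint of `‖Z‖²` and `1` is positive even when `Z = 0`, as the ratio test demands nonzero
  -- terms.
  set r : ℝ := (‖Z‖ ^ 2 + 1) / 2 with hr
  have hZ2 : ‖Z‖ ^ 2 < 1 := by
    rw [sq_lt_one_iff₀ (norm_nonneg Z)]
    exact hnorm
  have hr0 : 0 < r := by positivity
  have hs := (summable_mul_sqrt_majorant hr0 (by linarith) hT0 d).mul_left K
  set g : ℕ → ℝ := fun k => K * ((2 * (k : ℝ) + 1) ^ d * √(majorant r T k)) with hg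
  refine mem_fockSpace_of_norm_le (K := ∑' k, g k) (tsum_nonneg fun k => by positivity) fun ψ => ?_
  -- The family `e` depends on `ψ`, but the bound `g` was fixed before it.
  obtain ⟨n, e, he, -, hψ⟩ := exists_orthonormal_mem_symOf ψ ψ
  have hterm : ∀ k : ℕ,
      ‖(k.factorial : ℂ)⁻¹ * (incl φ * quadratic Z ^ k) ψ‖ ≤ g k * symNorm ψ := by
    intro k
    have h1 : (incl φ * quadratic Z ^ k) ψ = (incl φ * incl (compressedQuadratic e Z) ^ k) ψ :=
      Antidual.AgreeOn.mul (fun _ _ => rfl) ((agreeOn_quadratic he hZ).pow k) ψ hψ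
    have h2 : (k.factorial : ℂ)⁻¹ * (incl φ * quadratic Z ^ k) ψ =
        symInner ψ (φ * gaussTerm e Z k) := by
      rw [h1, ← map_pow, ← map_mul, incl_apply, gaussTerm, mul_smul_comm, symInner_smul_right]
    have h3 := (symNorm_gaussTerm_sq_le he hZ hr0.le hT0
      (fun v => (norm_compress_sq_le he v).trans ?_)
      ((Finset.sum_le_sum fun i _ => norm_compress_sq_le he (e i)).trans (hT n e he)) k).1
    · have h4 := (hφ _ _ (degLE_gaussTerm (e := e) (Z := Z) k)).2
      rw [h2]
      refine (norm_symInner_le _ _).trans ?_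
      rw [mul_comm]
      refine mul_le_mul_of_nonneg_right (h4.trans ?_) (symNorm_nonneg ψ)
      rw [hg, mul_assoc]
      push_cast
      gcongr
      exact Real.le_sqrt_of_sq_le h3
    · have h5 : ‖Z v‖ ^ 2 ≤ (‖Z‖ * ‖v‖) ^ 2 := by
        gcongr
        exact Z.le_opNorm v
      rw [mul_pow] at h5
      refine h5.trans ?_
      gcongr
      linarith
  have hsum := Antidual.hasSum_mul_exp (incl φ) (quadratic Z) (quadratic_one Z) ψ
  rw [gaussian, ← hsum.tsum_eq, ← tsum_mul_right]
  exact tsum_of_norm_bounded (hs.mul_right (symNorm ψ)).hasSum hterm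

/-! ### Words in creators and annihilators -/

theorem Letter.exists_op_incl_mul_gaussian {Z : V →SL[starRingEnd ℂ] V} (hZ : IsSymmetricAnti Z)
    (A : Letter V) (φ : Sym V) :
    ∃ φ', A.op (incl φ * gaussian Z) = incl φ' * gaussian Z := by
  cases A with
  | c v =>
    refine ⟨ι ℂ V v * φ, ?_⟩
    rw [Letter.op, Antidual.create_eq_ket_mul, map_mul, incl_ι, mul_assoc]
  | a v =>
    refine ⟨annihilate v φ + φ * ι ℂ V (Z v), ?_⟩
    rw [Letter.op, Antidual.annihilate_mul, annihilate_incl, annihilate_gaussian hZ, map_add,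
      map_mul, incl_ι, add_mul, mul_assoc]

theorem exists_wordOp_gaussian {Z : V →SL[starRingEnd ℂ] V} (hZ : IsSymmetricAnti Z)
    (w : List (Letter V)) : ∃ φ, wordOp w (gaussian Z) = incl φ * gaussian Z := by
  induction w with
  | nil => exact ⟨1, by simp [wordOp]⟩
  | cons A w ih =>
    obtain ⟨φ, hφ⟩ := ih
    obtain ⟨φ', hφ'⟩ := A.exists_op_incl_mul_gaussian hZ φ
    exact ⟨φ', by rw [wordOp, LinearMap.comp_apply, hφ, hφ']⟩

theorem exists_polynomial_op_gaussian {Z : V →SL[starRingEnd ℂ] V} (hZ : IsSymmetricAnti Z)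
    (p : CAPolynomial V) : ∃ φ, p.op (gaussian Z) = incl φ * gaussian Z := by
  choose φ hφ using exists_wordOp_gaussian hZ
  refine ⟨∑ w ∈ p.support, p w • φ w, ?_⟩
  simp [CAPolynomial.op, Finsupp.sum, hφ, Finset.sum_mul]

/-- Each intermediate vector is itself a word applied to `e^Z`, hence of the form `φ e^Z`, so every
domain condition follows from boundedness of such vectors. -/
theorem gaussian_mem_wordDomain {Z : V →SL[starRingEnd ℂ] V} (hHS : IsHilbertSchmidt Z)
    (hZ : IsSymmetricAnti Z) (hnorm : ‖Z‖ < 1) (w : List (Letter V)) :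
    gaussian Z ∈ wordDomain w := by
  have hmem : ∀ w : List (Letter V), wordOp w (gaussian Z) ∈ fockSpace V := by
    intro w
    obtain ⟨φ, hφ⟩ := exists_wordOp_gaussian hZ w
    rw [hφ]
    exact incl_mul_gaussian_mem_fockSpace hHS hZ hnorm φ
  induction w with
  | nil => exact hmem []
  | cons A w ih => exact ⟨ih, hmem w, hmem (A :: w)⟩

end BosonicFock

end

theorem mainTheorem12 {V : Type*} [NormedAddCommGroup V] [InnerProductSpace ℂ V] [CompleteSpace V]
    (Z : V →SL[starRingEnd ℂ] V) (hHS : BosonicFock.IsHilbertSchmidt Z)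
    (hsymm : BosonicFock.IsSymmetricAnti Z) (hnorm : ‖Z‖ < 1) :
    (∀ φ : BosonicFock.Sym V,
      BosonicFock.incl φ * BosonicFock.gaussian Z ∈ BosonicFock.fockSpace V) ∧
    (∀ p : BosonicFock.CAPolynomial V,
      BosonicFock.gaussian Z ∈ p.domain ∧
        p.op (BosonicFock.gaussian Z) ∈ BosonicFock.fockSpace V) := by
  refine ⟨BosonicFock.incl_mul_gaussian_mem_fockSpace hHS hsymm hnorm,
    fun p => ⟨⟨?_, fun w _ => ?_⟩, ?_⟩⟩
  · exact BosonicFock.gaussian_mem_wordDomain hHS hsymm hnorm []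
  · exact BosonicFock.gaussian_mem_wordDomain hHS hsymm hnorm w
  · obtain ⟨φ, hφ⟩ := BosonicFock.exists_polynomial_op_gaussian hsymm p
    rw [hφ]
    exact BosonicFock.incl_mul_gaussian_mem_fockSpace hHS hsymm hnorm φ
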